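/- Let $(M,J)$ be a (finite-dimensional, Hausdorff, $C^\infty$) manifold with a $C^\infty$ almost complex structure $J$. For a real $C^2$ function $u$, the Levi form of $u$ at $p$ on $t\in T_pM$ is $L^J_u(p;t)=-d(J^*du)(X,JX)(p)$, where $J^*du(Y)=du(JY)$ and $X$ is any smooth vector field near $p$ with $X(p)=t$; a $C^2$ function $u$ is strictly plurisubharmonic on an open set $V$ if $L^J_u(p;t)>0$ for all $p\in V$ and all $t\in T_pM\setminus\{0\}$. A $C^k$ defining function for an open set $\Omega$ on an open set $U$ is a real $C^k$ function $r$ on $U$ with $\Omega\cap U=\{q\in U: r(q)<0\}$ and $dr(p)\neq0$ for all $p\in b\Omega\cap U$; $\Omega$ has $C^k$ boundary if such functions exist near every point of $b\Omega$. $\Omega$ is Levi convex if for every $p\in b\Omega$ and some (equivalently, any) local $C^2$ defining function $s$ for $\Omega$ near $p$ one has $L^J_s(p;t)\ge0$ for all $t\in T_p(b\Omega)\cap J(T_p(b\Omega))$. A bounded exhaustion function for $\Omega$ is a continuous map $u:\Omega\to[a,0)$, for some $a<0$, such that $u^{-1}([a,b])$ is compact for every $a\le b<0$. **Theorem.** Let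 $\Omega\subset M$ be a relatively compact Levi convex domain with $C^3$ boundary, let $\varphi$ be a $C^2$ strictly plurisubharmonic function on an open neighbourhood $U$ of $b\Omega$, and let $r$ be any $C^3$ defining function for $\Omega$ on $U$. Then there exist an open neighbourhood $U'\subset U$ of $b\Omega$ and constants $A>0$, $0<\eta_0<1$ such that for every $0<\eta\le\eta_0$ the function $$\rho=-\left(-r\,e^{-A\varphi}\right)^{\eta}$$ is of class $C^2$ and strictly plurisubharmonic on $\Omega\cap U'$. If moreover $U\supset\overline\Omega$, then $U'$, $A$ and $\eta_0$ can be chosen so that, for every $0<\eta\le\eta_0$, $\rho$ is in addition strictly plurisubharmonic on all of $\Omega$ and is a bounded exhaustion function for $\Omega$. -/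

import Mathlib

open Set Topology
open scoped Manifold ContDiff

noncomputable section

section AlmostComplex

variable (E : Type*) [NormedAddCommGroup E] [NormedSpace ℝ E]
  (M : Type*) [TopologicalSpace M] [ChartedSpace E M] [IsManifold 𝓘(ℝ, E) ∞ M]

/-- A smooth almost complex structure on a manifold `M` modelled on `E`: a `C^∞` field of
endomorphisms of the tangent spaces (a smooth section of the bundle `End(TM)`) with
`J ^ 2 = -1`. -/
structure AlmostComplexStructure where
  /-- the endomorphism of the tangent space at each point -/
  toFun : ∀ p : M, TangentSpace 𝓘(ℝ, E) p →L[ℝ] TangentSpace 𝓘(ℝ, E) p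
  smooth : ContMDiff 𝓘(ℝ, E) (𝓘(ℝ, E).prod 𝓘(ℝ, E →L[ℝ] E)) ∞
    (fun p => Bundle.TotalSpace.mk' (E →L[ℝ] E)
      (E := fun q : M => TangentSpace 𝓘(ℝ, E) q →L[ℝ] TangentSpace 𝓘(ℝ, E) q) p (toFun p))
  sq_eq_neg : ∀ (p : M) (t : TangentSpace 𝓘(ℝ, E) p), toFun p (toFun p t) = -t

end AlmostComplex

section Levi

variable {E : Type*} [NormedAddCommGroup E] [NormedSpace ℝ E]
  {M : Type*} [TopologicalSpace M] [ChartedSpace E M]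

/-- The expression in a chart `e` of a `1`-form `α` on `M`, that is, the pull-back of `α` by
`e.symm`. -/
def formInChart (α : ∀ q : M, TangentSpace 𝓘(ℝ, E) q →L[ℝ] ℝ) (e : OpenPartialHomeomorph M E)
    (y : E) : E [⋀^Fin 1]→L[ℝ] ℝ :=
  ContinuousAlternatingMap.ofSubsingleton ℝ E ℝ (0 : Fin 1)
    ((α (e.symm y)).comp (mfderiv 𝓘(ℝ, E) 𝓘(ℝ, E) e.symm y))

/-- The exterior derivative `dα(v, w)` at `p` of a `1`-form `α` on `M`, computed in the preferred
chart at `p`, with the convention `dα(X, Y) = X(α(Y)) - Y(α(X)) - α([X, Y])`. -/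
def extDerivOneForm (α : ∀ q : M, TangentSpace 𝓘(ℝ, E) q →L[ℝ] ℝ) (p : M)
    (v w : TangentSpace 𝓘(ℝ, E) p) : ℝ :=
  extDeriv (formInChart α (chartAt E p)) (chartAt E p p)
    ![mfderiv 𝓘(ℝ, E) 𝓘(ℝ, E) (chartAt E p) p v, mfderiv 𝓘(ℝ, E) 𝓘(ℝ, E) (chartAt E p) p w]

variable [IsManifold 𝓘(ℝ, E) ∞ M]

/-- The `1`-form `J^* dr`, `X ↦ dr(J X)`. -/
def AlmostComplexStructure.pullbackDifferential (J : AlmostComplexStructure E M) (r : M → ℝ)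
    (q : M) : TangentSpace 𝓘(ℝ, E) q →L[ℝ] ℝ :=
  (mfderiv 𝓘(ℝ, E) 𝓘(ℝ, ℝ) r q).comp (J.toFun q)

/-- The Levi form `L_r^J(p; t) = -d(J^* dr)(t, J t)`. -/
def AlmostComplexStructure.leviForm (J : AlmostComplexStructure E M) (r : M → ℝ) (p : M)
    (t : TangentSpace 𝓘(ℝ, E) p) : ℝ :=
  -extDerivOneForm (J.pullbackDifferential r) p t (J.toFun p t)

/-- `u` is a strictly plurisubharmonic function of class `C^2` on the (open) set `V`. -/
def IsStrictlyPSHOn (J : AlmostComplexStructure E M) (u : M → ℝ) (V : Set M) : Prop :=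
  ContMDiffOn 𝓘(ℝ, E) 𝓘(ℝ, ℝ) 2 u V ∧
    ∀ p ∈ V, ∀ t : TangentSpace 𝓘(ℝ, E) p, t ≠ 0 → 0 < J.leviForm u p t

/-- `r` is a defining function of class `C^k` for `Ω` on the open set `U`: it is `C^k` on `U`,
`Ω ∩ U = {q ∈ U | r q < 0}`, and `dr ≠ 0` at the boundary points of `Ω` in `U`. -/
def IsDefiningFunctionOn (E : Type*) [NormedAddCommGroup E] [NormedSpace ℝ E]
    {M : Type*} [TopologicalSpace M] [ChartedSpace E M]
    (k : WithTop ℕ∞) (Ω U : Set M) (r : M → ℝ) : Prop :=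
  ContMDiffOn 𝓘(ℝ, E) 𝓘(ℝ, ℝ) k r U ∧ Ω ∩ U = {q ∈ U | r q < 0} ∧
    ∀ p ∈ frontier Ω ∩ U, mfderiv 𝓘(ℝ, E) 𝓘(ℝ, ℝ) r p ≠ 0

/-- `Ω` has boundary of class `C^k`: near every boundary point it has a `C^k` defining function. -/
def HasBoundaryOfClass (E : Type*) [NormedAddCommGroup E] [NormedSpace ℝ E]
    {M : Type*} [TopologicalSpace M] [ChartedSpace E M] (k : WithTop ℕ∞) (Ω : Set M) : Prop :=
  ∀ p ∈ frontier Ω, ∃ (V : Set M) (r : M → ℝ), IsOpen V ∧ p ∈ V ∧ IsDefiningFunctionOn E k Ω V r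

/-- `Ω` is Levi convex at the boundary point `p`: for a local `C^2` defining function `s` of `Ω`
near `p`, the Levi form of `s` at `p` is nonnegative on the holomorphic tangent space
`T_p(bΩ) ∩ J T_p(bΩ) = {t | ds(t) = 0 and ds(J t) = 0}`. -/
def IsLeviConvexAt (J : AlmostComplexStructure E M) (Ω : Set M) (p : M) : Prop :=
  ∃ (V : Set M) (s : M → ℝ), IsOpen V ∧ p ∈ V ∧ IsDefiningFunctionOn E 2 Ω V s ∧
    ∀ t : TangentSpace 𝓘(ℝ, E) p, mfderiv 𝓘(ℝ, E) 𝓘(ℝ, ℝ) s p t = 0 →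
      mfderiv 𝓘(ℝ, E) 𝓘(ℝ, ℝ) s p (J.toFun p t) = 0 → 0 ≤ J.leviForm s p t

/-- `Ω` is Levi convex: it is Levi convex at every boundary point. -/
def IsLeviConvex (J : AlmostComplexStructure E M) (Ω : Set M) : Prop :=
  ∀ p ∈ frontier Ω, IsLeviConvexAt J Ω p

end Levi

/-- `u` is a bounded exhaustion function for `Ω`: it is continuous on `Ω` with values in some
`[a, 0)`, and for every `a ≤ b < 0` the set `{p ∈ Ω | a ≤ u p ≤ b}` is compact. -/
def IsBoundedExhaustion {M : Type*} [TopologicalSpace M] (Ω : Set M) (u : M → ℝ) : Prop :=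
  ContinuousOn u Ω ∧ ∃ a < (0 : ℝ), (∀ p ∈ Ω, u p ∈ Ico a 0) ∧
    ∀ b : ℝ, a ≤ b → b < 0 → IsCompact (Ω ∩ u ⁻¹' Icc a b)

end

/-!
Write `ψ = log (-r) - A φ`, so that `ρ = -exp (η ψ)`. The chain rule `localLevi_comp`,
`L_{χ ∘ u}(t) = χ'(u) L_u(t) + χ''(u) (du(t)^2 + du(J t)^2)`, shows (`localLevi_neg_rpow`) that the
Levi form of `ρ` is a positive multiple of

  `A L_φ(t) + L_r(t) / |r| + |∂r(t)|^2 / r^2 - η |∂ψ(t)|^2`, where `|∂u(t)|^2 = du(t)^2 + du(J t)^2`.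

The only dangerous term is `L_r / |r|`. It is controlled by the lower bound
`L_r(t) ≥ -C (|r| |t|^2 + |t| (|dr(t)| + |dr(J t)|))` on `Ω` near `bΩ`
(`localLevi_lower_bound_of_zero`): since `r` is of class `C^3`, its Levi form is Lipschitz and may be
compared with the one at a boundary point at distance `O(|r|)`; there, by Levi convexity, it is
nonnegative on the complex tangent space, and the complement of that space is measured by `dr(t)`
and `dr(J t)`. After division by `|r|`, the cross term is absorbed by half of `|∂r|^2 / r^2` and a
multiple of `|t|^2`, the latter being dominated by `A L_φ` for `A` large. For `η` small compared
with `A^{-2}` the last term is harmless. At interior points the lower bound is trivial, so the same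
local statement (`exists_nhds_leviForm_neg_rpow_pos`) holds at all points of `Ω ∪ bΩ` in `U`, on a
neighbourhood that does not depend on `A` and `η`. Compactness of `bΩ`, or of the closure of `Ω` if
`U` contains it, then gives both parts of the theorem.

Two points of a more formal nature remain. Levi convexity is given by some defining function, and
`localLevi_nonneg_of_neg_iff` transfers it to `r`: two functions with the same negative set have
positively proportional differentials on the hypersurface, and their Hessians there compare along
its tangent directions, as one sees by following suitable parabolas. And the Levi form at `p` is
defined through the preferred chart at `p`, while the estimates need one chart for all points of a
neighbourhood; `AlmostComplexStructure.leviForm_eq_localLevi` provides this, by naturality of the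
exterior derivative.
-/

/-! ### The Levi form of functions on a vector space -/

section LocalLevi

variable {E : Type*} [NormedAddCommGroup E] [NormedSpace ℝ E]

/-- The `1`-form `K^* du`, `v ↦ du(K v)`, on a vector space with a field `K` of endomorphisms. -/
noncomputable def twistedDifferential (K : E → E →L[ℝ] E) (u : E → ℝ) (y : E) : E →L[ℝ] ℝ :=
  (fderiv ℝ u y).comp (K y)

/-- The Levi form `-d(K^* du)(t, K t)` on a vector space with a field `K` of endomorphisms. -/
noncomputable def localLevi (K : E → E →L[ℝ] E) (u : E → ℝ) (y t : E) : ℝ :=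
  -(fderiv ℝ (twistedDifferential K u) y t (K y t) -
    fderiv ℝ (twistedDifferential K u) y (K y t) t)

lemma ContDiffAt.twistedDifferential {K : E → E →L[ℝ] E} {u : E → ℝ} {y : E} {n m : WithTop ℕ∞}
    (hu : ContDiffAt ℝ n u y) (hK : ContDiffAt ℝ m K y) (hnm : m + 1 ≤ n) :
    ContDiffAt ℝ m (twistedDifferential K u) y :=
  (hu.fderiv_right hnm).clm_comp hK

lemma twistedDifferential_apply (K : E → E →L[ℝ] E) (u : E → ℝ) (y t : E) :
    twistedDifferential K u y t = fderiv ℝ u y (K y t) := rfl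

lemma localLevi_congr {K : E → E →L[ℝ] E} {u v : E → ℝ} {y : E} (h : u =ᶠ[𝓝 y] v) (t : E) :
    localLevi K u y t = localLevi K v y t := by
  have h1 : twistedDifferential K u =ᶠ[𝓝 y] twistedDifferential K v := by
    filter_upwards [h.fderiv (𝕜 := ℝ)] with z hz
    simp only [twistedDifferential, hz]
  simp only [localLevi, h1.fderiv_eq]

lemma localLevi_sub_mul {K : E → E →L[ℝ] E} {u v : E → ℝ} {y : E}
    (hK : DifferentiableAt ℝ K y) (hu : ContDiffAt ℝ 2 u y) (hv : ContDiffAt ℝ 2 v y)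
    (c : ℝ) (t : E) :
    localLevi K (fun z => u z - c * v z) y t = localLevi K u y t - c * localLevi K v y t := by
  have h1 : twistedDifferential K (fun z => u z - c * v z) =ᶠ[𝓝 y]
      fun z => twistedDifferential K u z - c • twistedDifferential K v z := by
    filter_upwards [hu.eventually (by simp), hv.eventually (by simp)] with z h1 h2
    have d1 := h1.differentiableAt (by simp)
    have d2 := h2.differentiableAt (by simp)
    ext w
    simp only [twistedDifferential, fderiv_fun_sub d1 (d2.const_mul c), fderiv_const_mul d2 c]
    simp
  have e1 : DifferentiableAt ℝ (twistedDifferential K u) y :=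
    ((hu.fderiv_right (m := 1) (by norm_num)).differentiableAt (by simp)).clm_comp hK
  have e2 : DifferentiableAt ℝ (twistedDifferential K v) y :=
    ((hv.fderiv_right (m := 1) (by norm_num)).differentiableAt (by simp)).clm_comp hK
  simp only [localLevi, h1.fderiv_eq]
  rw [(e1.hasFDerivAt.fun_sub (e2.hasFDerivAt.fun_const_smul c)).fderiv]
  simp only [sub_apply, smul_apply, smul_eq_mul]
  ring

/-- Chain rule for the Levi form:
`L_{χ ∘ u}(t) = χ'(u) L_u(t) + χ''(u) (du(t)^2 + du(K t)^2)`. -/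
lemma localLevi_comp {K : E → E →L[ℝ] E} {u : E → ℝ} {y : E} {χ : ℝ → ℝ}
    (hK : DifferentiableAt ℝ K y) (hK2 : ∀ t, K y (K y t) = -t)
    (hu : ContDiffAt ℝ 2 u y) (hχ : ContDiffAt ℝ 2 χ (u y)) (t : E) :
    localLevi K (fun z => χ (u z)) y t = deriv χ (u y) * localLevi K u y t +
      deriv (deriv χ) (u y) * ((fderiv ℝ u y t) ^ 2 + (fderiv ℝ u y (K y t)) ^ 2) := by
  have h1 : twistedDifferential K (fun z => χ (u z)) =ᶠ[𝓝 y]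
      fun z => deriv χ (u z) • twistedDifferential K u z := by
    filter_upwards [hu.eventually (by simp),
      hu.continuousAt.eventually (hχ.eventually (by simp))] with z h1 h2
    have d1 := h1.differentiableAt (by simp)
    have d2 := h2.differentiableAt (by simp)
    have := (d2.hasDerivAt.comp_hasFDerivAt z d1.hasFDerivAt).fderiv
    simp only [Function.comp_def] at this
    ext w
    simp [twistedDifferential, this]
  have e1 : DifferentiableAt ℝ (twistedDifferential K u) y :=
    ((hu.fderiv_right (m := 1) (by norm_num)).differentiableAt (by simp)).clm_comp hK
  have e2 : DifferentiableAt ℝ (deriv χ) (u y) := by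
    have : ContDiffAt ℝ 1 (deriv χ) (u y) := by
      have := hχ.fderiv_right (m := 1) (by norm_num)
      have h3 : deriv χ = fun x => fderiv ℝ χ x 1 := by ext x; simp
      rw [h3]
      exact this.clm_apply contDiffAt_const
    exact this.differentiableAt (by simp)
  have e3 := e2.hasDerivAt.comp_hasFDerivAt y (hu.differentiableAt (by simp)).hasFDerivAt
  have e4 := (e3.fun_smul e1.hasFDerivAt).fderiv
  simp only [Function.comp_apply] at e4
  simp only [localLevi, h1.fderiv_eq, e4]
  simp only [add_apply, smul_apply, smul_eq_mul,
    ContinuousLinearMap.smulRight_apply, twistedDifferential_apply, hK2, map_neg]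
  ring

/-- The Levi form of `-(-u e^{-A f})^η = -exp (η (log |u| - A f))` where `u < 0`. -/
lemma localLevi_neg_rpow {K : E → E →L[ℝ] E} {u f : E → ℝ} {y : E}
    (hK : DifferentiableAt ℝ K y) (hK2 : ∀ t, K y (K y t) = -t)
    (hu : ContDiffAt ℝ 2 u y) (hf : ContDiffAt ℝ 2 f y) (hneg : u y < 0) (A η : ℝ) (t : E) :
    localLevi K (fun z => -((-u z * Real.exp (-A * f z)) ^ η)) y t =
      η * (-u y * Real.exp (-A * f y)) ^ η *
        (A * localLevi K f y t - (u y)⁻¹ * localLevi K u y t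
          + ((fderiv ℝ u y t) ^ 2 + (fderiv ℝ u y (K y t)) ^ 2) / (u y) ^ 2
          - η * (((u y)⁻¹ * fderiv ℝ u y t - A * fderiv ℝ f y t) ^ 2
            + ((u y)⁻¹ * fderiv ℝ u y (K y t) - A * fderiv ℝ f y (K y t)) ^ 2)) := by
  have key : ∀ z, u z < 0 → (-u z * Real.exp (-A * f z)) ^ η =
      Real.exp (η * (Real.log (u z) - A * f z)) := by
    intro z hz
    rw [← Real.exp_log_of_neg hz, ← Real.exp_add, mul_comm η, Real.exp_mul, neg_mul,
      ← sub_eq_add_neg]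
  have hev : (fun z => -((-u z * Real.exp (-A * f z)) ^ η)) =ᶠ[𝓝 y]
      fun z => (fun s => -Real.exp (η * s)) ((fun z => Real.log (u z) - A * f z) z) := by
    filter_upwards [hu.continuousAt.eventually_lt continuousAt_const hneg] with z hz
    simp only [key z hz]
  have hl : ContDiffAt ℝ 2 (fun z => Real.log (u z)) y := hu.log hneg.ne
  have hψ : ContDiffAt ℝ 2 (fun z => Real.log (u z) - A * f z) y :=
    hl.sub (contDiffAt_const.mul hf)
  have d1 : deriv (fun s => -Real.exp (η * s)) = fun s => -η * Real.exp (η * s) := by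
    ext s
    have : HasDerivAt (fun s => -Real.exp (η * s)) (-(Real.exp (η * s) * (η * 1))) s :=
      (((hasDerivAt_id s).const_mul η).exp).neg
    rw [this.deriv]; ring
  have d2 : deriv (fun s => -η * Real.exp (η * s)) = fun s => -η ^ 2 * Real.exp (η * s) := by
    ext s
    have : HasDerivAt (fun s => -η * Real.exp (η * s)) (-η * (Real.exp (η * s) * (η * 1))) s :=
      (((hasDerivAt_id s).const_mul η).exp).const_mul (-η)
    rw [this.deriv]; ring
  have d3 : fderiv ℝ (fun z => Real.log (u z) - A * f z) y =
      (u y)⁻¹ • fderiv ℝ u y - A • fderiv ℝ f y := by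
    have h1 := (hu.differentiableAt (by simp)).hasFDerivAt.log hneg.ne
    have h2 := (hf.differentiableAt (by simp)).hasFDerivAt.const_mul A
    exact (h1.sub h2).fderiv
  have d4 : deriv (deriv Real.log) (u y) = -((u y) ^ 2)⁻¹ := by
    rw [Real.deriv_log', deriv_inv]
  rw [localLevi_congr hev,
    localLevi_comp (χ := fun s => -Real.exp (η * s)) hK hK2 hψ (by fun_prop), d1, d2, d3,
    localLevi_sub_mul hK hl hf, localLevi_comp hK hK2 hu (Real.contDiffAt_log.2 hneg.ne), d4,
    Real.deriv_log, key y hneg]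
  simp only [sub_apply, smul_apply, smul_eq_mul]
  ring

end LocalLevi

/-! ### Independence of the defining function -/

section DefiningFunctions

open Filter

variable {E : Type*} [NormedAddCommGroup E] [NormedSpace ℝ E]

lemma localLevi_eq_hessian {K : E → E →L[ℝ] E} {u : E → ℝ} {y : E}
    (hK : DifferentiableAt ℝ K y) (hK2 : ∀ t, K y (K y t) = -t) (hu : ContDiffAt ℝ 2 u y) (t : E) :
    localLevi K u y t = fderiv ℝ (fderiv ℝ u) y t t + fderiv ℝ (fderiv ℝ u) y (K y t) (K y t)
      + fderiv ℝ u y (fderiv ℝ K y (K y t) t - fderiv ℝ K y t (K y t)) := by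
  have h1 : HasFDerivAt (fderiv ℝ u) (fderiv ℝ (fderiv ℝ u) y) y :=
    ((hu.fderiv_right (m := 1) (by norm_num)).differentiableAt (by simp)).hasFDerivAt
  have h2 := (h1.clm_comp hK.hasFDerivAt).fderiv
  have h3 : twistedDifferential K u = fun z => (fderiv ℝ u z).comp (K z) := rfl
  simp only [localLevi, h3, h2]
  simp [hK2]
  ring

/-- A `C^2` function vanishing at `y` to first order in the direction `t` is positive along the
parabola `τ ↦ y + τ t + τ^2 w` for small `τ ≠ 0` if its second derivative there is positive. -/
lemma eventually_pos_along_parabola {u : E → ℝ} {y t w : E} (hu : ContDiffAt ℝ 2 u y)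
    (hy : u y = 0) (ht : fderiv ℝ u y t = 0)
    (hpos : 0 < fderiv ℝ (fderiv ℝ u) y t t + 2 * fderiv ℝ u y w) :
    ∀ᶠ τ : ℝ in 𝓝[>] 0, 0 < u (y + τ • t + τ ^ 2 • w) := by
  set γ : ℝ → E := fun τ => y + τ • t + τ ^ 2 • w with hγ
  have hγ0 : γ 0 = y := by simp [hγ]
  have hγd : ∀ τ, HasDerivAt γ (t + (2 * τ) • w) τ := by
    intro τ
    have h1 : HasDerivAt (fun τ : ℝ => τ • t) ((1 : ℝ) • t) τ := (hasDerivAt_id τ).smul_const t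
    have h2 : HasDerivAt (fun τ : ℝ => τ ^ 2 • w) ((2 * τ) • w) τ := by
      simpa using (hasDerivAt_pow 2 τ).smul_const w
    rw [one_smul] at h1
    exact (h1.const_add y).fun_add h2
  have hγc : ContinuousAt γ 0 := (hγd 0).continuousAt
  -- subtracting a small multiple of `τ ^ 2` keeps the second derivative positive, so that the local
  -- minimum of the difference gives strict positivity of `u` along the curve
  obtain ⟨c, hc0, hc⟩ : ∃ c : ℝ, 0 < c ∧
      2 * c < fderiv ℝ (fderiv ℝ u) y t t + 2 * fderiv ℝ u y w :=
    ⟨(fderiv ℝ (fderiv ℝ u) y t t + 2 * fderiv ℝ u y w) / 4, by linarith, by linarith⟩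
  have hev : ∀ᶠ τ in 𝓝 (0 : ℝ), HasDerivAt (fun τ => u (γ τ) - c * τ ^ 2)
      (fderiv ℝ u (γ τ) (t + (2 * τ) • w) - c * (2 * τ)) τ := by
    have : ∀ᶠ z in 𝓝 (γ 0), ContDiffAt ℝ 2 u z := by
      rw [hγ0]; exact hu.eventually (by simp)
    filter_upwards [hγc.eventually this] with τ h1
    have h2 := (h1.differentiableAt (by simp)).hasFDerivAt.comp_hasDerivAt τ (hγd τ)
    have h3 : HasDerivAt (fun τ : ℝ => c * τ ^ 2) (c * (2 * τ)) τ := by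
      simpa using (hasDerivAt_pow 2 τ).const_mul c
    exact h2.sub h3
  have hd1 : deriv (fun τ => u (γ τ) - c * τ ^ 2) =ᶠ[𝓝 0]
      fun τ => fderiv ℝ u (γ τ) (t + (2 * τ) • w) - c * (2 * τ) :=
    hev.mono fun τ h => h.deriv
  have hd2 : deriv (deriv (fun τ => u (γ τ) - c * τ ^ 2)) 0 =
      fderiv ℝ (fderiv ℝ u) y t t + 2 * fderiv ℝ u y w - 2 * c := by
    rw [hd1.deriv_eq]
    have h1 : HasFDerivAt (fderiv ℝ u) (fderiv ℝ (fderiv ℝ u) y) (γ 0) := by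
      rw [hγ0]
      exact ((hu.fderiv_right (m := 1) (by norm_num)).differentiableAt (by simp)).hasFDerivAt
    have h2 := h1.comp_hasDerivAt (0 : ℝ) (hγd 0)
    have h3 : HasDerivAt (fun τ : ℝ => t + (2 * τ) • w) ((2 * 1 : ℝ) • w) 0 :=
      (((hasDerivAt_id (0 : ℝ)).const_mul 2).smul_const w).const_add t
    have h4 : HasDerivAt (fun τ : ℝ => c * (2 * τ)) (c * (2 * 1)) 0 :=
      ((hasDerivAt_id (0 : ℝ)).const_mul 2).const_mul c
    have h5 := (h2.clm_apply h3).sub h4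
    have h6 := h5.deriv
    simp only [Function.comp_def, hγ0] at h6
    refine Eq.trans ?_ (h6.trans ?_)
    · rfl
    · simp; ring
  have hmin : IsLocalMin (fun τ => u (γ τ) - c * τ ^ 2) 0 := by
    apply isLocalMin_of_deriv_deriv_pos
    · rw [hd2]; linarith
    · rw [hd1.eq_of_nhds]; simp [hγ0, ht]
    · exact hev.self_of_nhds.continuousAt
  filter_upwards [nhdsWithin_le_nhds hmin, self_mem_nhdsWithin] with τ h1 h2
  simp only [hγ0, hy] at h1
  have h3 : (0 : ℝ) < τ := h2
  have : 0 < c * τ ^ 2 := by positivity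
  simp only [hγ] at h1
  norm_num at h1
  linarith

lemma eventually_pos_along_ray {u : E → ℝ} {y v : E} (hu : DifferentiableAt ℝ u y)
    (hy : u y = 0) (hv : 0 < fderiv ℝ u y v) : ∀ᶠ τ : ℝ in 𝓝[>] 0, 0 < u (y + τ • v) := by
  have h1 : HasDerivAt (fun τ : ℝ => y + τ • v) ((1 : ℝ) • v) 0 :=
    ((hasDerivAt_id (0 : ℝ)).smul_const v).const_add y
  have h0 : HasFDerivAt u (fderiv ℝ u y) (y + (0 : ℝ) • v) := by simpa using hu.hasFDerivAt
  have h2 := h0.comp_hasDerivAt (0 : ℝ) h1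
  rw [hasDerivAt_iff_tendsto_slope_zero] at h2
  simp only [one_smul] at h2
  have h3 := (h2.mono_left (nhdsWithin_mono _ (fun x (hx : (0 : ℝ) < x) => hx.ne'))).eventually
    (lt_mem_nhds hv)
  filter_upwards [h3, self_mem_nhdsWithin] with τ h4 h5
  simp only [Function.comp_apply, zero_add, zero_smul, add_zero, hy, sub_zero, smul_eq_mul] at h4
  exact (pos_iff_pos_of_mul_pos h4).1 (inv_pos.2 h5)

/-- Two functions which are negative at the same points near a common regular zero `y` have
positively proportional differentials at `y`, and their Hessians on the common kernel compare
with the same factor. -/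
lemma fderiv_eq_smul_of_neg_iff {u s : E → ℝ} {y : E} (hu : ContDiffAt ℝ 2 u y)
    (hs : ContDiffAt ℝ 2 s y) (huy : u y = 0) (hsy : s y = 0) (hdu : fderiv ℝ u y ≠ 0)
    (hds : fderiv ℝ s y ≠ 0) (hneg : ∀ᶠ z in 𝓝 y, s z < 0 ↔ u z < 0) :
    ∃ l : ℝ, 0 < l ∧ fderiv ℝ u y = l • fderiv ℝ s y ∧ ∀ t, fderiv ℝ s y t = 0 →
      l * fderiv ℝ (fderiv ℝ s) y t t ≤ fderiv ℝ (fderiv ℝ u) y t t := by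
  have hcontra : ∀ t w : E, (∀ᶠ τ : ℝ in 𝓝[>] 0, 0 < u (y + τ • t + τ ^ 2 • w)) →
      (∀ᶠ τ : ℝ in 𝓝[>] 0, s (y + τ • t + τ ^ 2 • w) < 0) → False := by
    intro t w h1 h2
    have h3 : Tendsto (fun τ : ℝ => y + τ • t + τ ^ 2 • w) (𝓝[>] 0) (𝓝 y) := by
      have : Continuous (fun τ : ℝ => y + τ • t + τ ^ 2 • w) := by fun_prop
      have := (this.tendsto 0).mono_left (nhdsWithin_le_nhds (s := Ioi 0))
      simpa using this
    obtain ⟨τ, a, b, c⟩ := (h1.and (h2.and (h3.eventually hneg))).exists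
    exact absurd (c.1 b) (by linarith)
  have hcontra' : ∀ t w : E, (∀ᶠ τ : ℝ in 𝓝[>] 0, u (y + τ • t + τ ^ 2 • w) < 0) →
      (∀ᶠ τ : ℝ in 𝓝[>] 0, 0 < s (y + τ • t + τ ^ 2 • w)) → False := by
    intro t w h1 h2
    have h3 : Tendsto (fun τ : ℝ => y + τ • t + τ ^ 2 • w) (𝓝[>] 0) (𝓝 y) := by
      have : Continuous (fun τ : ℝ => y + τ • t + τ ^ 2 • w) := by fun_prop
      have := (this.tendsto 0).mono_left (nhdsWithin_le_nhds (s := Ioi 0))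
      simpa using this
    obtain ⟨τ, a, b, c⟩ := (h1.and (h2.and (h3.eventually hneg))).exists
    exact absurd (c.2 a) (by linarith)
  have hu1 : DifferentiableAt ℝ u y := hu.differentiableAt (by simp)
  have hs1 : DifferentiableAt ℝ s y := hs.differentiableAt (by simp)
  have first : ∀ v, fderiv ℝ s y v < 0 → fderiv ℝ u y v ≤ 0 := by
    intro v hv
    by_contra! h
    apply hcontra v 0
    · simpa using eventually_pos_along_ray hu1 huy h
    · have := eventually_pos_along_ray (u := fun z => -s z) (v := v) hs1.fun_neg (by simp [hsy])
        (by rw [fderiv_fun_neg]; simpa using hv)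
      simpa using this
  obtain ⟨v₀, hv₀⟩ : ∃ v, fderiv ℝ s y v = 1 := by
    obtain ⟨v, hv⟩ : ∃ v, fderiv ℝ s y v ≠ 0 := by
      by_contra! h
      exact hds (ContinuousLinearMap.ext fun v => by simpa using h v)
    exact ⟨(fderiv ℝ s y v)⁻¹ • v, by simp [hv]⟩
  have hker : ∀ v, fderiv ℝ s y v = 0 → fderiv ℝ u y v ≤ 0 := by
    intro v hv
    by_contra! h
    obtain ⟨ε, hε, hε'⟩ : ∃ ε : ℝ, 0 < ε ∧ ε * |fderiv ℝ u y v₀| < fderiv ℝ u y v := by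
      refine ⟨fderiv ℝ u y v / (|fderiv ℝ u y v₀| + 1), by positivity, ?_⟩
      rw [div_mul_eq_mul_div, div_lt_iff₀ (by positivity)]
      nlinarith
    have := first (v - ε • v₀) (by simp [hv, hv₀, hε])
    simp only [map_sub, map_smul, smul_eq_mul] at this
    nlinarith [le_abs_self (fderiv ℝ u y v₀)]
  have hker' : ∀ v, fderiv ℝ s y v = 0 → fderiv ℝ u y v = 0 := by
    intro v hv
    refine le_antisymm (hker v hv) ?_
    simpa using hker (-v) (by simp [hv])
  have heq : fderiv ℝ u y = fderiv ℝ u y v₀ • fderiv ℝ s y := by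
    ext v
    have := hker' (v - fderiv ℝ s y v • v₀) (by simp [hv₀])
    simp only [map_sub, map_smul, smul_eq_mul] at this
    simp only [smul_apply, smul_eq_mul]
    linarith
  have hl : 0 < fderiv ℝ u y v₀ := by
    have h1 := first (-v₀) (by simp [hv₀])
    simp only [map_neg] at h1
    refine lt_of_le_of_ne (by linarith) fun h => hdu ?_
    rw [heq, ← h, zero_smul]
  refine ⟨fderiv ℝ u y v₀, hl, heq, fun t ht => ?_⟩
  by_contra! h
  set l := fderiv ℝ u y v₀ with hl_def
  set a := fderiv ℝ (fderiv ℝ s) y t t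
  set b := fderiv ℝ (fderiv ℝ u) y t t
  -- bending the line `y + τ t` by `c v₀` separates the two second derivatives
  obtain ⟨c, hc1, hc2⟩ : ∃ c : ℝ, 0 < a + 2 * c ∧ b + 2 * (l * c) < 0 := by
    refine ⟨-(l * a + b) / (4 * l), ?_, ?_⟩
    · have : a + 2 * (-(l * a + b) / (4 * l)) = (l * a - b) / (2 * l) := by
        field_simp; ring
      rw [this]
      apply div_pos <;> linarith
    · have : b + 2 * (l * (-(l * a + b) / (4 * l))) = (b - l * a) / 2 := by
        field_simp; ring
      rw [this]; linarith
  apply hcontra' t (c • v₀)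
  · have hfd : fderiv ℝ (fun z => -u z) = fun z => -fderiv ℝ u z := by
      ext z v; rw [fderiv_fun_neg]
    have := eventually_pos_along_parabola (u := fun z => -u z) (t := t) (w := c • v₀) hu.neg
      (by simp [huy]) (by rw [hfd]; simp [hker' t ht])
      (by
        rw [hfd, fderiv_fun_neg]
        simp only [neg_apply, map_smul, smul_eq_mul]
        change 0 < -b + 2 * (c * -l)
        linarith)
    simpa using this
  · apply eventually_pos_along_parabola hs hsy ht
    simp only [map_smul, smul_eq_mul, hv₀]
    simpa using hc1

/-- Nonnegativity of the Levi form on the complex tangent space of a hypersurface does not depend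
on the defining function. -/
lemma localLevi_nonneg_of_neg_iff {K : E → E →L[ℝ] E} {u s : E → ℝ} {y : E}
    (hK : DifferentiableAt ℝ K y) (hK2 : ∀ t, K y (K y t) = -t) (hu : ContDiffAt ℝ 2 u y)
    (hs : ContDiffAt ℝ 2 s y) (huy : u y = 0) (hsy : s y = 0) (hdu : fderiv ℝ u y ≠ 0)
    (hds : fderiv ℝ s y ≠ 0) (hneg : ∀ᶠ z in 𝓝 y, s z < 0 ↔ u z < 0)
    (hlevi : ∀ t, fderiv ℝ s y t = 0 → fderiv ℝ s y (K y t) = 0 → 0 ≤ localLevi K s y t)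
    {t : E} (ht : fderiv ℝ u y t = 0) (hKt : fderiv ℝ u y (K y t) = 0) :
    0 ≤ localLevi K u y t := by
  obtain ⟨l, hl, heq, hess⟩ := fderiv_eq_smul_of_neg_iff hu hs huy hsy hdu hds hneg
  simp only [heq, smul_apply, smul_eq_mul, mul_eq_zero, hl.ne', false_or] at ht hKt
  have h1 := hlevi t ht hKt
  rw [localLevi_eq_hessian hK hK2 hs] at h1
  rw [localLevi_eq_hessian hK hK2 hu, heq]
  have h2 := hess t ht
  have h3 := hess _ hKt
  simp only [smul_apply, smul_eq_mul]
  nlinarith [mul_nonneg hl.le h1]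

end DefiningFunctions

/-! ### Lower bounds for the Levi form near a Levi convex hypersurface -/

section LowerBound

open Filter

variable {E : Type*} [NormedAddCommGroup E] [NormedSpace ℝ E]

/-- A bilinear form whose associated quadratic form is the Levi form at `y`. -/
noncomputable def localLeviBilin (K : E → E →L[ℝ] E) (u : E → ℝ) (y : E) : E →L[ℝ] E →L[ℝ] ℝ :=
  (fderiv ℝ (twistedDifferential K u) y).comp (K y) -
    ((ContinuousLinearMap.compL ℝ E E ℝ).flip (K y)).comp (fderiv ℝ (twistedDifferential K u) y)

lemma localLeviBilin_self (K : E → E →L[ℝ] E) (u : E → ℝ) (y t : E) :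
    localLeviBilin K u y t t = localLevi K u y t := by
  simp [localLeviBilin, localLevi]

lemma ContDiffAt.localLeviBilin {K : E → E →L[ℝ] E} {u : E → ℝ} {y : E} {n m k : WithTop ℕ∞}
    (hu : ContDiffAt ℝ n u y) (hK : ContDiffAt ℝ m K y) (hnm : m + 1 ≤ n) (hkm : k + 1 ≤ m) :
    ContDiffAt ℝ k (localLeviBilin K u) y := by
  have h1 := (hu.twistedDifferential hK hnm).fderiv_right hkm
  have h2 : ContDiffAt ℝ k K y := hK.of_le (le_trans le_self_add hkm)
  refine (h1.clm_comp h2).sub (ContDiffAt.clm_comp ?_ h1)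
  have h3 : ContDiff ℝ k fun T : E →L[ℝ] E => (ContinuousLinearMap.compL ℝ E E ℝ).flip T :=
    ContinuousLinearMap.contDiff _
  exact h3.contDiffAt.comp y h2

lemma abs_apply_apply_le {G : E →L[ℝ] E →L[ℝ] ℝ} {C : ℝ} (hG : ‖G‖ ≤ C) (v w : E) :
    |G v w| ≤ C * (‖v‖ * ‖w‖) := by
  calc |G v w| = ‖G v w‖ := rfl
    _ ≤ ‖G‖ * ‖v‖ * ‖w‖ := G.le_opNorm₂ v w
    _ ≤ C * (‖v‖ * ‖w‖) := by rw [mul_assoc]; gcongr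

/-- A bilinear form nonnegative on the complex subspace `ker a ∩ ker (a ∘ k)` is bounded below by
a multiple of `‖t‖ (|a t| + |a (k t)|)`: the component of `t` along the complex line spanned by a
transversal vector `n` is linear in `(a t, a (k t))`. -/
lemma lower_bound_of_nonneg_on_complex_kernel {G : E →L[ℝ] E →L[ℝ] ℝ} {a : E →L[ℝ] ℝ}
    {k : E →L[ℝ] E} {n : E} {C : ℝ} (hC : 1 ≤ C) (hk2 : ∀ t, k (k t) = -t) (hG : ‖G‖ ≤ C)
    (ha : ‖a‖ ≤ C) (hk : ‖k‖ ≤ C) (hn : ‖n‖ ≤ C) (han : 1 / 2 ≤ a n)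
    (hpos : ∀ t, a t = 0 → a (k t) = 0 → 0 ≤ G t t) (t : E) :
    -((2 * C + 16 * C ^ 8) * (8 * C ^ 5)) * (‖t‖ * (|a t| + |a (k t)|)) ≤ G t t := by
  have hC0 : 0 ≤ C := by linarith
  have hat : ∀ v, |a v| ≤ C * ‖v‖ := fun v => a.le_of_opNorm_le ha v
  have hkt : ∀ v, ‖k v‖ ≤ C * ‖v‖ := fun v => k.le_of_opNorm_le hk v
  -- `tN` is the element of the span of `n` and `k n` with `a tN = a t` and `a (k tN) = a (k t)`
  set δ := |a t| + |a (k t)| with hδ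
  have hδ0 : 0 ≤ δ := by positivity
  set d := (a n) ^ 2 + (a (k n)) ^ 2 with hd
  have hd4 : 1 / 4 ≤ d := by nlinarith [sq_nonneg (a (k n))]
  have hd0 : d ≠ 0 := by linarith
  set x := (a t * a n + a (k t) * a (k n)) / d with hx
  set z := (a t * a (k n) - a (k t) * a n) / d with hz
  set tN := x • n + z • k n with htN
  have hkn : ‖k n‖ ≤ C ^ 2 := (hkt n).trans (by nlinarith)
  have han' : |a n| ≤ C ^ 3 :=
    (hat n).trans (by nlinarith [pow_le_pow_right₀ hC (show 2 ≤ 3 by norm_num)])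
  have hakn' : |a (k n)| ≤ C ^ 3 := (hat _).trans (by nlinarith)
  have hdiv : ∀ p, |p| ≤ C ^ 3 * δ → |p / d| ≤ 4 * C ^ 3 * δ := by
    intro p hp
    rw [abs_div, abs_of_pos (show 0 < d by linarith), div_le_iff₀ (by linarith)]
    have : 0 ≤ C ^ 3 * δ := by positivity
    linarith [mul_le_mul_of_nonneg_left hd4 this]
  have hxb : |x| ≤ 4 * C ^ 3 * δ := by
    refine hdiv _ ((abs_add_le _ _).trans ?_)
    rw [abs_mul, abs_mul, hδ]
    linarith [mul_le_mul_of_nonneg_left han' (abs_nonneg (a t)),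
      mul_le_mul_of_nonneg_left hakn' (abs_nonneg (a (k t)))]
  have hzb : |z| ≤ 4 * C ^ 3 * δ := by
    refine hdiv _ ((abs_sub _ _).trans ?_)
    rw [abs_mul, abs_mul, hδ]
    linarith [mul_le_mul_of_nonneg_left hakn' (abs_nonneg (a t)),
      mul_le_mul_of_nonneg_left han' (abs_nonneg (a (k t)))]
  have htNb : ‖tN‖ ≤ 8 * C ^ 5 * δ := by
    calc ‖tN‖ ≤ ‖x • n‖ + ‖z • k n‖ := norm_add_le _ _
      _ = |x| * ‖n‖ + |z| * ‖k n‖ := by simp [norm_smul]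
      _ ≤ (4 * C ^ 3 * δ) * C ^ 2 + (4 * C ^ 3 * δ) * C ^ 2 := by
        gcongr
        exact hn.trans (by nlinarith)
      _ = 8 * C ^ 5 * δ := by ring
  have hδt : δ ≤ 2 * C ^ 2 * ‖t‖ := by
    have h1 := hat t
    have h2 := (hat (k t)).trans (mul_le_mul_of_nonneg_left (hkt t) hC0)
    have h3 : C * ‖t‖ ≤ C ^ 2 * ‖t‖ := by gcongr; nlinarith
    rw [hδ]; linarith
  have hH : 0 ≤ G (t - tN) (t - tN) := by
    have e1 : x * a n + z * a (k n) = a t := by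
      rw [hx, hz]; field_simp; rw [hd]; ring
    have e2 : x * a (k n) - z * a n = a (k t) := by
      rw [hx, hz]; field_simp; rw [hd]; ring
    apply hpos
    · simp only [htN, map_sub, map_add, map_smul, smul_eq_mul]; linarith
    · simp only [htN, map_sub, map_add, map_smul, smul_eq_mul, hk2, map_neg]; linarith
  -- `t - tN` lies in the complex kernel, so only terms containing `tN` can be negative
  have hexp : G t t = G (t - tN) (t - tN) + G t tN + G tN t - G tN tN := by
    simp only [map_sub, sub_apply]; ring
  have b1 := neg_abs_le (G t tN)
  have b2 := neg_abs_le (G tN t)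
  have b3 := le_abs_self (G tN tN)
  have c1 := abs_apply_apply_le hG t tN
  have c2 := abs_apply_apply_le hG tN t
  have c3 := abs_apply_apply_le hG tN tN
  have c4 : C * (‖tN‖ * ‖tN‖) ≤ 16 * C ^ 8 * (‖t‖ * ‖tN‖) := by
    calc C * (‖tN‖ * ‖tN‖) ≤ C * ((8 * C ^ 5 * (2 * C ^ 2 * ‖t‖)) * ‖tN‖) := by
          gcongr; exact htNb.trans (by gcongr)
      _ = 16 * C ^ 8 * (‖t‖ * ‖tN‖) := by ring
  have c5 : (2 * C + 16 * C ^ 8) * (‖t‖ * ‖tN‖) ≤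
      (2 * C + 16 * C ^ 8) * (‖t‖ * (8 * C ^ 5 * δ)) := by gcongr
  linarith

/-- Points close to a regular zero where `u` is negative are within `2 |u(y)| ‖n‖` of the zero set,
where `n` is a transversal direction. -/
lemma exists_zero_near {u : E → ℝ} {y₀ n : E} {ε : ℝ} (hε : 0 < ε)
    (hu : ∀ y ∈ Metric.ball y₀ ε, DifferentiableAt ℝ u y)
    (hn : ∀ y ∈ Metric.ball y₀ ε, 1 / 2 ≤ fderiv ℝ u y n) (h0 : u y₀ = 0) :
    ∀ᶠ y in 𝓝 y₀, u y < 0 → ∃ z ∈ Metric.ball y₀ ε, u z = 0 ∧ ‖z - y‖ ≤ 2 * |u y| * ‖n‖ := by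
  have hc : ContinuousAt (fun y => 2 * |u y| * ‖n‖) y₀ :=
    ((continuousAt_const.mul (hu y₀ (Metric.mem_ball_self hε)).continuousAt.abs).mul
      continuousAt_const)
  have h1 : ∀ᶠ y in 𝓝 y₀, 2 * |u y| * ‖n‖ < ε / 2 :=
    hc.eventually_lt continuousAt_const (by simp [h0, hε])
  filter_upwards [h1, Metric.ball_mem_nhds y₀ (half_pos hε)] with y h2 h3 hy
  have hball : ∀ σ ∈ Icc (0 : ℝ) (2 * |u y|), y + σ • n ∈ Metric.ball y₀ ε := by
    intro σ hσ
    rw [Metric.mem_ball, dist_eq_norm] at h3 ⊢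
    calc ‖y + σ • n - y₀‖ = ‖(y - y₀) + σ • n‖ := by congr 1; abel
      _ ≤ ‖y - y₀‖ + |σ| * ‖n‖ := by
        refine (norm_add_le _ _).trans ?_
        rw [norm_smul, Real.norm_eq_abs]
      _ ≤ ‖y - y₀‖ + 2 * |u y| * ‖n‖ := by
        rw [abs_of_nonneg hσ.1]; gcongr; exact hσ.2
      _ < ε := by linarith
  have hd : ∀ σ ∈ Icc (0 : ℝ) (2 * |u y|),
      HasDerivAt (fun σ : ℝ => u (y + σ • n)) (fderiv ℝ u (y + σ • n) n) σ := by
    intro σ hσ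
    have h5 : HasDerivAt (fun τ : ℝ => y + τ • n) ((1 : ℝ) • n) σ :=
      ((hasDerivAt_id σ).smul_const n).const_add y
    rw [one_smul] at h5
    exact (hu _ (hball σ hσ)).hasFDerivAt.comp_hasDerivAt σ h5
  have hcont : ContinuousOn (fun σ : ℝ => u (y + σ • n)) (Icc 0 (2 * |u y|)) :=
    fun σ hσ => (hd σ hσ).continuousAt.continuousWithinAt
  have hle : (0 : ℝ) ≤ 2 * |u y| := by positivity
  have hmv := (convex_Icc (0 : ℝ) (2 * |u y|)).mul_sub_le_image_sub_of_le_deriv hcont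
    (fun σ hσ => (hd σ (interior_subset hσ)).differentiableAt.differentiableWithinAt)
    (C := 1 / 2) (fun σ hσ => by
      rw [(hd σ (interior_subset hσ)).deriv]
      exact hn _ (hball σ (interior_subset hσ)))
    0 (left_mem_Icc.2 hle) (2 * |u y|) (right_mem_Icc.2 hle) hle
  have hiv := intermediate_value_Icc hle hcont
  obtain ⟨σ, hσ, hσ0⟩ := hiv (show (0 : ℝ) ∈ _ by
    simp only [zero_smul, add_zero, sub_zero] at hmv ⊢
    refine ⟨hy.le, ?_⟩
    rw [abs_of_neg hy] at hmv ⊢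
    linarith)
  refine ⟨y + σ • n, hball σ hσ, hσ0, ?_⟩
  rw [add_sub_cancel_left, norm_smul, Real.norm_eq_abs, abs_of_nonneg hσ.1]
  gcongr
  exact hσ.2

lemma eventually_norm_le_of_continuousAt {X F : Type*} [TopologicalSpace X] [SeminormedAddCommGroup F] {g : X → F}
    {y₀ : X} (hg : ContinuousAt g y₀) : ∀ᶠ y in 𝓝 y₀, ‖g y‖ ≤ ‖g y₀‖ + 1 :=
  (hg.norm.eventually_lt continuousAt_const (lt_add_one _)).mono fun _ h => h.le

/-- A lower bound for the Levi form at `z` gives one at a nearby point `y`, with an error controlled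
by the variation of the first derivatives and of the Levi form between the two points. -/
lemma localLevi_lower_bound_transfer {K : E → E →L[ℝ] E} {u : E → ℝ} {y z t : E} {C D d : ℝ}
    (hC : 0 ≤ C) (hD : 0 ≤ D) (hd : 0 ≤ d) (da : ‖fderiv ℝ u z - fderiv ℝ u y‖ ≤ D * d)
    (db : ‖twistedDifferential K u z - twistedDifferential K u y‖ ≤ D * d)
    (dg : ‖localLeviBilin K u z - localLeviBilin K u y‖ ≤ D * d)
    (hz : -C * (‖t‖ * (|fderiv ℝ u z t| + |fderiv ℝ u z (K z t)|)) ≤ localLevi K u z t) :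
    -(C + 2 * C * D + D) * (d * ‖t‖ ^ 2 +
      ‖t‖ * (|fderiv ℝ u y t| + |fderiv ℝ u y (K y t)|)) ≤ localLevi K u y t := by
  have ea : |fderiv ℝ u z t| ≤ |fderiv ℝ u y t| + D * d * ‖t‖ := by
    have h1 : |(fderiv ℝ u z - fderiv ℝ u y) t| ≤ _ :=
      ContinuousLinearMap.le_of_opNorm_le _ da t
    rw [sub_apply] at h1
    linarith [abs_sub_abs_le_abs_sub (fderiv ℝ u z t) (fderiv ℝ u y t)]
  have eb : |fderiv ℝ u z (K z t)| ≤ |fderiv ℝ u y (K y t)| + D * d * ‖t‖ := by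
    have h1 : |(twistedDifferential K u z - twistedDifferential K u y) t| ≤ _ :=
      ContinuousLinearMap.le_of_opNorm_le _ db t
    rw [sub_apply, twistedDifferential_apply, twistedDifferential_apply] at h1
    linarith [abs_sub_abs_le_abs_sub (fderiv ℝ u z (K z t)) (fderiv ℝ u y (K y t))]
  have eg : localLevi K u z t - D * d * (‖t‖ * ‖t‖) ≤ localLevi K u y t := by
    have h1 := abs_apply_apply_le dg t t
    rw [sub_apply, sub_apply, localLeviBilin_self K u y, localLeviBilin_self K u z] at h1
    linarith [le_abs_self (localLevi K u z t - localLevi K u y t)]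
  have ha0 : 0 ≤ |fderiv ℝ u y t| + |fderiv ℝ u y (K y t)| := by positivity
  generalize |fderiv ℝ u y t| = a at *
  generalize |fderiv ℝ u y (K y t)| = b at *
  have h5 : C * (‖t‖ * (|fderiv ℝ u z t| + |fderiv ℝ u z (K z t)|)) ≤
      C * (‖t‖ * (a + b + 2 * (D * d * ‖t‖))) :=
    mul_le_mul_of_nonneg_left (mul_le_mul_of_nonneg_left (by linarith) (norm_nonneg t)) hC
  have h6 : 0 ≤ (2 * C * D + D) * (‖t‖ * (a + b)) := by positivity
  have h7 : 0 ≤ C * (d * ‖t‖ ^ 2) := by positivity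
  linarith

lemma LipschitzOnWith.norm_sub_le_mul {X F : Type*} [SeminormedAddCommGroup X]
    [SeminormedAddCommGroup F] {g : X → F} {s : Set X} {c : NNReal} {C d : ℝ} {y z : X}
    (hg : LipschitzOnWith c g s) (hz : z ∈ s) (hy : y ∈ s) (hc : (c : ℝ) ≤ C) (hzy : ‖z - y‖ ≤ d) : ‖g z - g y‖ ≤ C * d := by
  have h := hg.dist_le_mul z hz y hy
  rw [dist_eq_norm, dist_eq_norm] at h
  exact h.trans (mul_le_mul hc hzy (norm_nonneg _) (c.coe_nonneg.trans hc))

/-- Lower bound for the Levi form of a defining function on the negative side of a Levi convex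
hypersurface. This is where three derivatives of `u` are used: the Levi form is
Lipschitz, so it can be compared with the one at a nearby point of the hypersurface. -/
lemma localLevi_lower_bound_of_zero {K : E → E →L[ℝ] E} {u : E → ℝ} {y₀ : E}
    (hK : ContDiffAt ℝ 2 K y₀) (hK2 : ∀ᶠ y in 𝓝 y₀, ∀ t, K y (K y t) = -t)
    (hu : ContDiffAt ℝ 3 u y₀) (h0 : u y₀ = 0) (hdu : fderiv ℝ u y₀ ≠ 0)
    (hlevi : ∀ᶠ y in 𝓝 y₀, u y = 0 → ∀ t, fderiv ℝ u y t = 0 → fderiv ℝ u y (K y t) = 0 →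
      0 ≤ localLevi K u y t) :
    ∃ C : ℝ, 0 < C ∧ ∀ᶠ y in 𝓝 y₀, u y < 0 → ∀ t,
      -C * (|u y| * ‖t‖ ^ 2 + ‖t‖ * (|fderiv ℝ u y t| + |fderiv ℝ u y (K y t)|)) ≤
        localLevi K u y t := by
  have hb : ContDiffAt ℝ 1 (twistedDifferential K u) y₀ :=
    (hu.twistedDifferential hK (by norm_num)).of_le (by norm_num)
  have ha : ContDiffAt ℝ 1 (fderiv ℝ u) y₀ :=
    hu.fderiv_right (by exact_mod_cast (by norm_num : (1 : ℕ) + 1 ≤ 3))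
  have hG : ContDiffAt ℝ 1 (localLeviBilin K u) y₀ :=
    hu.localLeviBilin hK (by norm_num) (by norm_num)
  obtain ⟨Ca, sa, hsa, hLa⟩ := ha.exists_lipschitzOnWith
  obtain ⟨Cb, sb, hsb, hLb⟩ := hb.exists_lipschitzOnWith
  obtain ⟨Cg, sg, hsg, hLg⟩ := hG.exists_lipschitzOnWith
  obtain ⟨n, hn⟩ : ∃ v, fderiv ℝ u y₀ v = 1 := by
    obtain ⟨v, hv⟩ : ∃ v, fderiv ℝ u y₀ v ≠ 0 := by
      by_contra! h
      exact hdu (ContinuousLinearMap.ext fun v => by simpa using h v)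
    exact ⟨(fderiv ℝ u y₀ v)⁻¹ • v, by simp [hv]⟩
  obtain ⟨C, hC⟩ : ∃ C : ℝ, C = 1 + Ca + Cb + Cg + ‖n‖ + (‖fderiv ℝ u y₀‖ + 1) + (‖K y₀‖ + 1) +
    (‖localLeviBilin K u y₀‖ + 1) := ⟨_, rfl⟩
  have p1 := Ca.coe_nonneg
  have p2 := Cb.coe_nonneg
  have p3 := Cg.coe_nonneg
  have p4 := norm_nonneg n
  have p5 := norm_nonneg (fderiv ℝ u y₀)
  have p6 := norm_nonneg (K y₀)
  have p7 := norm_nonneg (localLeviBilin K u y₀)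
  have hC1 : 1 ≤ C := by linarith
  have hdn : ∀ᶠ y in 𝓝 y₀, 1 / 2 ≤ fderiv ℝ u y n := by
    have : ContinuousAt (fun y => fderiv ℝ u y n) y₀ := ha.continuousAt.clm_apply continuousAt_const
    exact (continuousAt_const.eventually_lt this (by rw [hn]; norm_num)).mono fun _ h => h.le
  have hall : ∀ᶠ y in 𝓝 y₀, (y ∈ sa ∧ y ∈ sb ∧ y ∈ sg) ∧ DifferentiableAt ℝ u y ∧
      1 / 2 ≤ fderiv ℝ u y n ∧ (∀ t, K y (K y t) = -t) ∧
      (‖fderiv ℝ u y‖ ≤ C ∧ ‖K y‖ ≤ C ∧ ‖localLeviBilin K u y‖ ≤ C) ∧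
      (u y = 0 → ∀ t, fderiv ℝ u y t = 0 → fderiv ℝ u y (K y t) = 0 → 0 ≤ localLevi K u y t) := by
    filter_upwards [hsa, hsb, hsg, hdn, hK2, hlevi,
      hu.eventually (by simp),
      eventually_norm_le_of_continuousAt ha.continuousAt,
      eventually_norm_le_of_continuousAt hK.continuousAt,
      eventually_norm_le_of_continuousAt hG.continuousAt] with y q1 q2 q3 q4 q5 q6 q7 q8 q9 q10
    exact ⟨⟨q1, q2, q3⟩, q7.differentiableAt (by simp), q4, q5,
      ⟨by linarith, by linarith, by linarith⟩, q6⟩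
  obtain ⟨ε, hε, hball⟩ := Metric.eventually_nhds_iff_ball.1 hall
  have hnear := exists_zero_near hε (fun y hy => (hball y hy).2.1)
    (fun y hy => (hball y hy).2.2.1) h0
  set C' := (2 * C + 16 * C ^ 8) * (8 * C ^ 5) with hC'
  have hC'0 : 0 < C' := by positivity
  refine ⟨C' + 2 * C' * (C * 2 * C) + C * 2 * C, by positivity, ?_⟩
  filter_upwards [hnear, Metric.ball_mem_nhds y₀ hε] with y hy hyb hneg t
  obtain ⟨z, hz, hz0, hzy⟩ := hy hneg
  obtain ⟨⟨ya, yb, yg⟩, -⟩ := hball y hyb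
  obtain ⟨⟨za, zb, zg⟩, -, hzn, hzK, ⟨hz1, hz2, hz3⟩, hzL⟩ := hball z hz
  have hnC : ‖n‖ ≤ C := by linarith
  have hzy' : ‖z - y‖ ≤ 2 * C * |u y| := by
    refine hzy.trans ?_
    rw [mul_right_comm]
    gcongr
  have hbound := lower_bound_of_nonneg_on_complex_kernel hC1 hzK hz3 hz1 hz2 hnC hzn
    (fun t h1 h2 => by rw [localLeviBilin_self]; exact hzL hz0 t h1 h2) t
  rw [← hC'] at hbound
  have da := hLa.norm_sub_le_mul za ya (show (Ca : ℝ) ≤ C by linarith) hzy'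
  have db := hLb.norm_sub_le_mul zb yb (show (Cb : ℝ) ≤ C by linarith) hzy'
  have dg := hLg.norm_sub_le_mul zg yg (show (Cg : ℝ) ≤ C by linarith) hzy'
  rw [← mul_assoc, ← mul_assoc] at da db dg
  rw [localLeviBilin_self] at hbound
  exact localLevi_lower_bound_transfer hC'0.le (by positivity) (abs_nonneg _) da db dg hbound

/-- At points where `u` is negative, the lower bound only expresses that the Levi form is locally
bounded. -/
lemma localLevi_lower_bound_of_neg {K : E → E →L[ℝ] E} {u : E → ℝ} {y₀ : E}
    (hK : ContDiffAt ℝ 2 K y₀) (hu : ContDiffAt ℝ 3 u y₀) (h0 : u y₀ < 0) :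
    ∃ C : ℝ, 0 < C ∧ ∀ᶠ y in 𝓝 y₀, u y < 0 → ∀ t,
      -C * (|u y| * ‖t‖ ^ 2 + ‖t‖ * (|fderiv ℝ u y t| + |fderiv ℝ u y (K y t)|)) ≤
        localLevi K u y t := by
  have hG : ContDiffAt ℝ 1 (localLeviBilin K u) y₀ :=
    hu.localLeviBilin hK (by norm_num) (by norm_num)
  set B := ‖localLeviBilin K u y₀‖ + 1 with hB
  have hB0 : 0 < B := by positivity
  refine ⟨B * (2 / -u y₀), mul_pos hB0 (div_pos two_pos (by linarith)), ?_⟩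
  filter_upwards [eventually_norm_le_of_continuousAt hG.continuousAt,
    hu.continuousAt.eventually_lt continuousAt_const (show u y₀ < u y₀ / 2 by linarith)]
    with y h1 h2 h3 t
  have h4 := abs_apply_apply_le h1 t t
  rw [localLeviBilin_self] at h4
  have h5 := neg_abs_le (localLevi K u y t)
  have h6 : 1 ≤ 2 / -u y₀ * |u y| := by
    rw [abs_of_neg h3, div_mul_eq_mul_div, le_div_iff₀ (by linarith)]
    linarith
  have h7 : B * (‖t‖ * ‖t‖) ≤ B * (2 / -u y₀) * (|u y| * ‖t‖ ^ 2) := by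
    calc B * (‖t‖ * ‖t‖) = B * (1 * ‖t‖ ^ 2) := by ring
      _ ≤ B * ((2 / -u y₀ * |u y|) * ‖t‖ ^ 2) := by gcongr
      _ = _ := by ring
  have h8 : 0 ≤ B * (2 / -u y₀) * (‖t‖ * (|fderiv ℝ u y t| + |fderiv ℝ u y (K y t)|)) := by
    have : 0 < 2 / -u y₀ := div_pos two_pos (by linarith)
    positivity
  linarith

/-- Strict positivity of the Levi form at a point is uniform near that point. -/
lemma localLevi_coercive [FiniteDimensional ℝ E] {K : E → E →L[ℝ] E} {f : E → ℝ} {y₀ : E}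
    (hK : ContDiffAt ℝ 1 K y₀) (hf : ContDiffAt ℝ 2 f y₀)
    (hpos : ∀ t, t ≠ 0 → 0 < localLevi K f y₀ t) :
    ∃ c : ℝ, 0 < c ∧ ∀ᶠ y in 𝓝 y₀, ∀ t, c * ‖t‖ ^ 2 ≤ localLevi K f y t := by
  have hG : ContDiffAt ℝ 0 (localLeviBilin K f) y₀ :=
    hf.localLeviBilin hK (by norm_num) (by norm_num)
  obtain ⟨c, hc, hcs⟩ : ∃ c : ℝ, 0 < c ∧
      ∀ t ∈ Metric.sphere (0 : E) 1, c ≤ localLeviBilin K f y₀ t t := by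
    have hcont : Continuous fun t => localLeviBilin K f y₀ t t :=
      (localLeviBilin K f y₀).continuous.clm_apply continuous_id
    refine (isCompact_sphere (0 : E) 1).exists_forall_le' hcont.continuousOn fun t ht => ?_
    rw [localLeviBilin_self]
    exact hpos t (ne_zero_of_mem_unit_sphere ⟨t, ht⟩)
  refine ⟨c / 2, half_pos hc, ?_⟩
  have h1 := Metric.continuousAt_iff'.1 hG.continuousAt (c / 2) (half_pos hc)
  filter_upwards [h1] with y hy t
  rw [dist_eq_norm] at hy
  have h2 := abs_apply_apply_le hy.le t t
  rw [sub_apply, sub_apply, localLeviBilin_self K f y] at h2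
  have h3 : c * ‖t‖ ^ 2 ≤ localLeviBilin K f y₀ t t := by
    rcases eq_or_ne t 0 with rfl | ht
    · simp
    have h4 := hcs (‖t‖⁻¹ • t) (by simp [norm_smul, ht])
    simp only [map_smul, smul_apply, smul_eq_mul] at h4
    have h5 : 0 < ‖t‖ := norm_pos_iff.2 ht
    calc c * ‖t‖ ^ 2 ≤ (‖t‖⁻¹ * (‖t‖⁻¹ * localLeviBilin K f y₀ t t)) * ‖t‖ ^ 2 := by gcongr
      _ = _ := by field_simp
  nlinarith [neg_abs_le (localLevi K f y t - localLeviBilin K f y₀ t t)]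

/-- Cauchy-Schwarz type estimate absorbing the negative terms in the Levi form of
`-(-u e^{-A f})^η`; there `P = du(t) / u`, `Q = du(K t) / u`, `p = df(t)`, `q = df(K t)` and
`T = ‖t‖`. -/
lemma rpow_levi_estimate {A C η T P Q p q a b : ℝ} (hη : 0 < η) (hη8 : η ≤ 1 / 8)
    (hηA : η * (A ^ 2 * (2 * (a + b))) ≤ 1) (hp : p ^ 2 ≤ a * T ^ 2) (hq : q ^ 2 ≤ b * T ^ 2) :
    η * ((P - A * p) ^ 2 + (Q - A * q) ^ 2) + C * (T * (|P| + |Q|)) ≤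
      (P ^ 2 + Q ^ 2) + (C ^ 2 + 1) * T ^ 2 := by
  have h5 : (P - A * p) ^ 2 + (Q - A * q) ^ 2 ≤
      2 * (P ^ 2 + Q ^ 2) + A ^ 2 * (2 * (a + b)) * T ^ 2 := by
    have a1 := sq_nonneg (P + A * p)
    have a2 := sq_nonneg (Q + A * q)
    have a3 := mul_le_mul_of_nonneg_left hp (sq_nonneg A)
    have a4 := mul_le_mul_of_nonneg_left hq (sq_nonneg A)
    linarith
  have b1 := mul_le_mul_of_nonneg_left h5 hη.le
  have b2 := mul_le_mul_of_nonneg_right hηA (sq_nonneg T)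
  have b3 := mul_le_mul_of_nonneg_right hη8 (add_nonneg (sq_nonneg P) (sq_nonneg Q))
  have h7 : C * (T * (|P| + |Q|)) ≤ C ^ 2 * T ^ 2 + (P ^ 2 + Q ^ 2) / 2 := by
    have c1 := sq_nonneg (C * T - (|P| + |Q|) / 2)
    have c2 := sq_nonneg (|P| - |Q|)
    rw [← sq_abs P, ← sq_abs Q]
    linarith
  linarith [sq_nonneg P, sq_nonneg Q]

/-- Positivity of the Levi form of `-(-u e^{-A f})^η` near a point, given the lower bound for the
Levi form of `u`. -/
lemma localLevi_neg_rpow_pos {K : E → E →L[ℝ] E} {u f : E → ℝ} {y₀ : E} {C c : ℝ}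
    (hK : ContDiffAt ℝ 1 K y₀) (hK2 : ∀ᶠ y in 𝓝 y₀, ∀ t, K y (K y t) = -t)
    (hu : ContDiffAt ℝ 2 u y₀) (hf : ContDiffAt ℝ 2 f y₀) (hC : 0 < C) (hc : 0 < c)
    (hlow : ∀ᶠ y in 𝓝 y₀, u y < 0 → ∀ t,
      -C * (|u y| * ‖t‖ ^ 2 + ‖t‖ * (|fderiv ℝ u y t| + |fderiv ℝ u y (K y t)|)) ≤
        localLevi K u y t)
    (hco : ∀ᶠ y in 𝓝 y₀, ∀ t, c * ‖t‖ ^ 2 ≤ localLevi K f y t) :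
    ∃ A₀ F : ℝ, 0 < A₀ ∧ 0 < F ∧ ∀ᶠ y in 𝓝 y₀, u y < 0 → ∀ A η : ℝ, A₀ ≤ A → 0 < η → η ≤ 1 / 8 →
      η * (A ^ 2 * F) ≤ 1 → ∀ t, t ≠ 0 →
        0 < localLevi K (fun z => -((-u z * Real.exp (-A * f z)) ^ η)) y t := by
  have hdf : ContDiffAt ℝ 1 (fderiv ℝ f) y₀ := hf.fderiv_right (by norm_num)
  set N := ‖fderiv ℝ f y₀‖ + 1 with hN
  set k := ‖K y₀‖ + 1 with hk
  have hN0 : 0 < N := by positivity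
  have hk0 : 0 < k := by positivity
  refine ⟨(C + C ^ 2 + 2) / c, 2 * (N ^ 2 + (N * k) ^ 2), by positivity, by positivity, ?_⟩
  filter_upwards [hK2, hlow, hco, hu.eventually (by simp), hf.eventually (by simp),
    hK.eventually (by simp),
    eventually_norm_le_of_continuousAt hdf.continuousAt,
    eventually_norm_le_of_continuousAt hK.continuousAt] with y yK2 ylow yco yu yf yK yN yk
    hneg A η hA hη hη8 hηA t ht
  rw [localLevi_neg_rpow (yK.differentiableAt (by simp)) yK2 yu yf hneg]
  have hm : 0 < (-u y * Real.exp (-A * f y)) ^ η :=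
    Real.rpow_pos_of_pos (mul_pos (by linarith) (Real.exp_pos _)) _
  refine mul_pos (mul_pos hη hm) ?_
  have h1 := ylow hneg t
  have h2 := yco t
  have h3 : |fderiv ℝ f y t| ≤ N * ‖t‖ := ContinuousLinearMap.le_of_opNorm_le _ yN t
  have h4 : |fderiv ℝ f y (K y t)| ≤ N * k * ‖t‖ := by
    refine (ContinuousLinearMap.le_of_opNorm_le _ yN (K y t)).trans ?_
    rw [mul_assoc]
    gcongr
    exact ContinuousLinearMap.le_of_opNorm_le _ yk t
  have ht0 : 0 < ‖t‖ := norm_pos_iff.2 ht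
  have hA0 : 0 < A := lt_of_lt_of_le (by positivity) hA
  have hAc : C + C ^ 2 + 2 ≤ A * c := (div_le_iff₀ hc).1 hA
  set p := fderiv ℝ u y t
  set q := fderiv ℝ u y (K y t)
  set p' := fderiv ℝ f y t
  set q' := fderiv ℝ f y (K y t)
  -- work with `P = du(t) / u` and `Q = du(K t) / u`
  obtain ⟨P, hP⟩ : ∃ P, P = (u y)⁻¹ * p := ⟨_, rfl⟩
  obtain ⟨Q, hQ⟩ : ∃ Q, Q = (u y)⁻¹ * q := ⟨_, rfl⟩
  have hne : u y ≠ 0 := hneg.ne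
  have e1 : (p ^ 2 + q ^ 2) / u y ^ 2 = P ^ 2 + Q ^ 2 := by
    rw [hP, hQ]; field_simp
  have e2 : -C * (‖t‖ ^ 2 + ‖t‖ * (|P| + |Q|)) ≤ -((u y)⁻¹ * localLevi K u y t) := by
    have hi : 0 < -(u y)⁻¹ := by rw [neg_pos]; exact inv_lt_zero.2 hneg
    have h5 := mul_le_mul_of_nonneg_left h1 hi.le
    have hu1 : -(u y)⁻¹ * |u y| = 1 := by rw [abs_of_neg hneg]; field_simp
    have hP' : |P| = -(u y)⁻¹ * |p| := by rw [hP, abs_mul, abs_inv, abs_of_neg hneg, ← neg_inv]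
    have hQ' : |Q| = -(u y)⁻¹ * |q| := by rw [hQ, abs_mul, abs_inv, abs_of_neg hneg, ← neg_inv]
    calc _ = -C * ((-(u y)⁻¹ * |u y|) * ‖t‖ ^ 2 + ‖t‖ * (|P| + |Q|)) := by rw [hu1, one_mul]
      _ = -(u y)⁻¹ * (-C * (|u y| * ‖t‖ ^ 2 + ‖t‖ * (|p| + |q|))) := by rw [hP', hQ']; ring
      _ ≤ _ := h5
      _ = _ := by ring
  rw [e1, ← hP, ← hQ]
  have h3' : p' ^ 2 ≤ N ^ 2 * ‖t‖ ^ 2 := by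
    rw [← mul_pow]; exact sq_le_sq' (by linarith [neg_abs_le p']) ((le_abs_self _).trans h3)
  have h4' : q' ^ 2 ≤ (N * k) ^ 2 * ‖t‖ ^ 2 := by
    rw [← mul_pow]; exact sq_le_sq' (by linarith [neg_abs_le q']) ((le_abs_self _).trans h4)
  have h8 : A * (c * ‖t‖ ^ 2) ≤ A * localLevi K f y t := by gcongr
  have h9 := mul_le_mul_of_nonneg_right hAc (sq_nonneg ‖t‖)
  have h10 := rpow_levi_estimate (P := P) (Q := Q) (C := C) hη hη8 hηA h3' h4'
  have h11 := sq_pos_of_pos ht0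
  linarith

end LowerBound

/-! ### The Levi form in charts -/

section LeviFormInCharts

open Filter

variable {E : Type*} [NormedAddCommGroup E] [NormedSpace ℝ E]
  {M : Type*} [TopologicalSpace M] [ChartedSpace E M]

/-- The expression of an almost complex structure in a chart `e`, that is, `De ∘ J ∘ De⁻¹`. It is
meaningful on the target of `e` only. -/
noncomputable def AlmostComplexStructure.inChart [IsManifold 𝓘(ℝ, E) ∞ M]
    (J : AlmostComplexStructure E M) (e : OpenPartialHomeomorph M E) (y : E) : E →L[ℝ] E :=
  (mfderiv 𝓘(ℝ, E) 𝓘(ℝ, E) e (e.symm y)).comp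
    ((J.toFun (e.symm y)).comp (mfderiv 𝓘(ℝ, E) 𝓘(ℝ, E) e.symm y))

lemma DifferentiableAt.ofSubsingleton {β : E → E →L[ℝ] ℝ} {y : E} (hβ : DifferentiableAt ℝ β y) :
    DifferentiableAt ℝ
      (fun z => ContinuousAlternatingMap.ofSubsingleton ℝ E ℝ (0 : Fin 1) (β z)) y := by
  have h := (ContinuousAlternatingMap.ofSubsingletonLIE (𝕜 := ℝ) (E := E) (F := ℝ) (0 : Fin 1)).differentiable
  exact (h (β y)).comp y hβ

lemma extDeriv_ofSubsingleton_apply {β : E → E →L[ℝ] ℝ} {y : E} (hβ : DifferentiableAt ℝ β y)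
    (v w : E) :
    extDeriv (fun z => ContinuousAlternatingMap.ofSubsingleton ℝ E ℝ (0 : Fin 1) (β z)) y ![v, w] =
      fderiv ℝ β y v w - fderiv ℝ β y w v := by
  have h : ∀ v w : E, fderiv ℝ (fun z => β z w) y v = fderiv ℝ β y v w := by
    intro v w
    have h1 := (hβ.hasFDerivAt.clm_apply (hasFDerivAt_const w y)).fderiv
    rw [h1]; simp
  rw [extDeriv_apply hβ.ofSubsingleton, Fin.sum_univ_two]
  simp [Fin.removeNth, h]
  ring

variable [IsManifold 𝓘(ℝ, E) ∞ M] {e e' : OpenPartialHomeomorph M E}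

lemma mdifferentiable_chart_of_mem_atlas (he : e ∈ atlas E M) :
    e.MDifferentiable 𝓘(ℝ, E) 𝓘(ℝ, E) :=
  have : IsManifold 𝓘(ℝ, E) 1 M := IsManifold.of_le (n := ∞) (by simp)
  mdifferentiable_of_mem_atlas he

lemma mem_maximalAtlas_of_mem_atlas (he : e ∈ atlas E M) (n : ℕ) :
    e ∈ IsManifold.maximalAtlas 𝓘(ℝ, E) (n : WithTop ℕ∞) M :=
  IsManifold.maximalAtlas_subset_of_le (n := ∞) (by exact_mod_cast le_top)
    (IsManifold.subset_maximalAtlas he)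

lemma ContMDiffAt.eventually_two {u : M → ℝ} {p : M} (hu : ContMDiffAt 𝓘(ℝ, E) 𝓘(ℝ, ℝ) 2 u p) :
    ∀ᶠ q in 𝓝 p, ContMDiffAt 𝓘(ℝ, E) 𝓘(ℝ, ℝ) 2 u q :=
  have : IsManifold 𝓘(ℝ, E) 2 M := IsManifold.of_le (m := 2) (n := ∞)
    (WithTop.coe_le_coe.2 (le_top : (2 : ℕ∞) ≤ ⊤))
  (contMDiffAt_iff_contMDiffAt_nhds (by simp)).1 hu

lemma mfderiv_symm_mfderiv_chart (he : e ∈ atlas E M) {y : E} (hy : y ∈ e.target)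
    (t : TangentSpace 𝓘(ℝ, E) (e.symm y)) :
    mfderiv 𝓘(ℝ, E) 𝓘(ℝ, E) e.symm y (mfderiv 𝓘(ℝ, E) 𝓘(ℝ, E) e (e.symm y) t) = t := by
  have h := (mdifferentiable_chart_of_mem_atlas he).symm_comp_deriv (e.map_target hy)
  rw [e.right_inv hy] at h
  exact DFunLike.congr_fun h t

lemma mfderiv_chart_mfderiv_symm (he : e ∈ atlas E M) {y : E} (hy : y ∈ e.target) (v : E) :
    mfderiv 𝓘(ℝ, E) 𝓘(ℝ, E) e (e.symm y) (mfderiv 𝓘(ℝ, E) 𝓘(ℝ, E) e.symm y v) = v :=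
  DFunLike.congr_fun ((mdifferentiable_chart_of_mem_atlas he).comp_symm_deriv hy) v

lemma AlmostComplexStructure.inChart_mfderiv (J : AlmostComplexStructure E M)
    (he : e ∈ atlas E M) {y : E} (hy : y ∈ e.target) (t : TangentSpace 𝓘(ℝ, E) (e.symm y)) :
    J.inChart e y (mfderiv 𝓘(ℝ, E) 𝓘(ℝ, E) e (e.symm y) t) =
      mfderiv 𝓘(ℝ, E) 𝓘(ℝ, E) e (e.symm y) (J.toFun (e.symm y) t) := by
  change mfderiv 𝓘(ℝ, E) 𝓘(ℝ, E) e (e.symm y) (J.toFun (e.symm y)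
    (mfderiv 𝓘(ℝ, E) 𝓘(ℝ, E) e.symm y (mfderiv 𝓘(ℝ, E) 𝓘(ℝ, E) e (e.symm y) t))) = _
  rw [mfderiv_symm_mfderiv_chart he hy]

lemma AlmostComplexStructure.inChart_inChart (J : AlmostComplexStructure E M)
    (he : e ∈ atlas E M) {y : E} (hy : y ∈ e.target) (v : E) :
    J.inChart e y (J.inChart e y v) = -v := by
  conv_lhs => rw [← mfderiv_chart_mfderiv_symm he hy v]
  rw [J.inChart_mfderiv he hy, J.inChart_mfderiv he hy, J.sq_eq_neg]
  rw [map_neg]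
  exact congrArg Neg.neg (mfderiv_chart_mfderiv_symm he hy v)

lemma fderiv_comp_chart_symm (he : e ∈ atlas E M) {y : E} (hy : y ∈ e.target) {u : M → ℝ}
    (hu : MDifferentiableAt 𝓘(ℝ, E) 𝓘(ℝ, ℝ) u (e.symm y)) :
    fderiv ℝ (u ∘ e.symm) y =
      (mfderiv 𝓘(ℝ, E) 𝓘(ℝ, ℝ) u (e.symm y)).comp (mfderiv 𝓘(ℝ, E) 𝓘(ℝ, E) e.symm y) := by
  rw [← mfderiv_eq_fderiv]
  exact mfderiv_comp y hu ((mdifferentiable_chart_of_mem_atlas he).mdifferentiableAt_symm hy)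

lemma fderiv_comp_chart_symm_mfderiv (he : e ∈ atlas E M) {y : E} (hy : y ∈ e.target) {u : M → ℝ}
    (hu : MDifferentiableAt 𝓘(ℝ, E) 𝓘(ℝ, ℝ) u (e.symm y))
    (t : TangentSpace 𝓘(ℝ, E) (e.symm y)) :
    fderiv ℝ (u ∘ e.symm) y (mfderiv 𝓘(ℝ, E) 𝓘(ℝ, E) e (e.symm y) t) =
      mfderiv 𝓘(ℝ, E) 𝓘(ℝ, ℝ) u (e.symm y) t := by
  rw [fderiv_comp_chart_symm he hy hu]
  exact congrArg (mfderiv 𝓘(ℝ, E) 𝓘(ℝ, ℝ) u (e.symm y)) (mfderiv_symm_mfderiv_chart he hy t)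

lemma ContMDiffAt.contDiffAt_comp_chart_symm (he : e ∈ atlas E M) {y : E} (hy : y ∈ e.target)
    {u : M → ℝ} {n : ℕ} (hu : ContMDiffAt 𝓘(ℝ, E) 𝓘(ℝ, ℝ) n u (e.symm y)) :
    ContDiffAt ℝ n (u ∘ e.symm) y := by
  rw [← contMDiffAt_iff_contDiffAt]
  exact hu.comp y (contMDiffAt_symm_of_mem_maximalAtlas (mem_maximalAtlas_of_mem_atlas he n) hy)

lemma formInChart_pullbackDifferential (J : AlmostComplexStructure E M) (he : e ∈ atlas E M)
    {y : E} (hy : y ∈ e.target) {u : M → ℝ}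
    (hu : MDifferentiableAt 𝓘(ℝ, E) 𝓘(ℝ, ℝ) u (e.symm y)) :
    formInChart (J.pullbackDifferential u) e y =
      ContinuousAlternatingMap.ofSubsingleton ℝ E ℝ (0 : Fin 1)
        (twistedDifferential (J.inChart e) (u ∘ e.symm) y) := by
  unfold formInChart
  congr 1
  ext v
  have h := fderiv_comp_chart_symm_mfderiv he hy hu
    (J.toFun (e.symm y) (mfderiv 𝓘(ℝ, E) 𝓘(ℝ, E) e.symm y v))
  exact h.symm

/-- The expressions of a `1`-form in two charts are related by pull-back along the change of
coordinates. -/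
lemma formInChart_eq_pullback (α : ∀ q : M, TangentSpace 𝓘(ℝ, E) q →L[ℝ] ℝ)
    (he : e ∈ atlas E M) (he' : e' ∈ atlas E M) {y : E} (hy : y ∈ e'.target)
    (hy' : e'.symm y ∈ e.source) :
    formInChart α e' y =
      (formInChart α e ((e ∘ e'.symm) y)).compContinuousLinearMap (fderiv ℝ (e ∘ e'.symm) y) := by
  have hd : fderiv ℝ (e ∘ e'.symm) y =
      (mfderiv 𝓘(ℝ, E) 𝓘(ℝ, E) e (e'.symm y)).comp (mfderiv 𝓘(ℝ, E) 𝓘(ℝ, E) e'.symm y) := by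
    rw [← mfderiv_eq_fderiv]
    exact mfderiv_comp y ((mdifferentiable_chart_of_mem_atlas he).mdifferentiableAt hy')
      ((mdifferentiable_chart_of_mem_atlas he').mdifferentiableAt_symm hy)
  ext v
  have key : ∀ p : M, p ∈ e.source → ∀ t : TangentSpace 𝓘(ℝ, E) p,
      α (e.symm (e p)) (mfderiv 𝓘(ℝ, E) 𝓘(ℝ, E) e.symm (e p)
        (mfderiv 𝓘(ℝ, E) 𝓘(ℝ, E) e p t)) = α p t := by
    intro p hp t
    obtain ⟨z, hz, rfl⟩ : ∃ z ∈ e.target, e.symm z = p := ⟨e p, e.map_source hp, e.left_inv hp⟩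
    have h := mfderiv_symm_mfderiv_chart he hz t
    have h2 : ∀ w : E, w = z → α (e.symm w) (mfderiv 𝓘(ℝ, E) 𝓘(ℝ, E) e.symm w
        (mfderiv 𝓘(ℝ, E) 𝓘(ℝ, E) e (e.symm z) t)) = α (e.symm z) t := by
      rintro w rfl
      rw [h]
    exact h2 _ (e.right_inv hz)
  have h3 := key (e'.symm y) hy' (mfderiv 𝓘(ℝ, E) 𝓘(ℝ, E) e'.symm y (v 0))
  rw [hd]
  exact h3.symm

/-- The exterior derivative of a `1`-form may be computed in any chart of the atlas. -/
lemma extDerivOneForm_eq_extDeriv (α : ∀ q : M, TangentSpace 𝓘(ℝ, E) q →L[ℝ] ℝ)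
    (he : e ∈ atlas E M) {p : M} (hp : p ∈ e.source)
    (hα : DifferentiableAt ℝ (formInChart α e) (e p)) (v w : TangentSpace 𝓘(ℝ, E) p) :
    extDerivOneForm α p v w = extDeriv (formInChart α e) (e p)
      ![mfderiv 𝓘(ℝ, E) 𝓘(ℝ, E) e p v, mfderiv 𝓘(ℝ, E) 𝓘(ℝ, E) e p w] := by
  set e' := chartAt E p with he'_def
  have he' : e' ∈ atlas E M := chart_mem_atlas E p
  have hp' : p ∈ e'.source := mem_chart_source E p
  have hsymm : e'.symm (e' p) = p := e'.left_inv hp'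
  have hg : ContDiffAt ℝ 2 (e ∘ e'.symm) (e' p) := by
    rw [← contMDiffAt_iff_contDiffAt]
    refine ContMDiffAt.comp (e' p) ?_
      (contMDiffAt_symm_of_mem_maximalAtlas (mem_maximalAtlas_of_mem_atlas he' 2) (e'.map_source hp'))
    rw [hsymm]
    exact contMDiffAt_of_mem_maximalAtlas (mem_maximalAtlas_of_mem_atlas he 2) hp
  have hev : formInChart α e' =ᶠ[𝓝 (e' p)] fun y =>
      (formInChart α e ((e ∘ e'.symm) y)).compContinuousLinearMap (fderiv ℝ (e ∘ e'.symm) y) := by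
    have h1 : ∀ᶠ y in 𝓝 (e' p), e'.symm y ∈ e.source := by
      apply (e'.continuousAt_symm (e'.map_source hp')).eventually
      rw [hsymm]
      exact e.open_source.mem_nhds hp
    filter_upwards [h1, e'.open_target.mem_nhds (e'.map_source hp')] with y hy1 hy2
    exact formInChart_eq_pullback α he he' hy2 hy1
  have hgp : (e ∘ e'.symm) (e' p) = e p := by rw [Function.comp_apply, hsymm]
  have hpull : extDeriv (fun y => (formInChart α e ((e ∘ e'.symm) y)).compContinuousLinearMap
      (fderiv ℝ (e ∘ e'.symm) y)) (e' p) = (extDeriv (formInChart α e)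
        ((e ∘ e'.symm) (e' p))).compContinuousLinearMap (fderiv ℝ (e ∘ e'.symm) (e' p)) :=
    extDeriv_pullback (by rw [hgp]; exact hα) hg (by simp)
  have hD : ∀ t : TangentSpace 𝓘(ℝ, E) p, fderiv ℝ (e ∘ e'.symm) (e' p)
      (mfderiv 𝓘(ℝ, E) 𝓘(ℝ, E) e' p t) = mfderiv 𝓘(ℝ, E) 𝓘(ℝ, E) e p t := by
    intro t
    have h1 : (e ∘ e'.symm) ∘ e' =ᶠ[𝓝 p] e := by
      filter_upwards [e'.open_source.mem_nhds hp'] with q hq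
      simp [e'.left_inv hq]
    have h2 := h1.mfderiv_eq (I := 𝓘(ℝ, E)) (I' := 𝓘(ℝ, E))
    have h3 := mfderiv_comp p (I := 𝓘(ℝ, E)) (I' := 𝓘(ℝ, E)) (I'' := 𝓘(ℝ, E))
      (g := e ∘ e'.symm) (f := e')
      (hg.differentiableAt (by simp)).mdifferentiableAt
      ((mdifferentiable_chart_of_mem_atlas he').mdifferentiableAt hp')
    rw [mfderiv_eq_fderiv] at h3
    exact (DFunLike.congr_fun h3 t).symm.trans (DFunLike.congr_fun h2 t)
  unfold extDerivOneForm
  rw [← he'_def, hev.extDeriv_eq, hpull, hgp]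
  rw [← hD v, ← hD w]
  refine congrArg (extDeriv (formInChart α e) (e p)) ?_
  funext i
  fin_cases i <;> rfl

/-- The Levi form of a `C^2` function may be computed in any chart in which the almost complex
structure is differentiable. -/
lemma AlmostComplexStructure.leviForm_eq_localLevi (J : AlmostComplexStructure E M)
    (he : e ∈ atlas E M) {y : E} (hy : y ∈ e.target)
    (hJ : DifferentiableAt ℝ (J.inChart e) y) {u : M → ℝ}
    (hu : ContMDiffAt 𝓘(ℝ, E) 𝓘(ℝ, ℝ) 2 u (e.symm y)) (t : TangentSpace 𝓘(ℝ, E) (e.symm y)) :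
    J.leviForm u (e.symm y) t = localLevi (J.inChart e) (u ∘ e.symm) y
      (mfderiv 𝓘(ℝ, E) 𝓘(ℝ, E) e (e.symm y) t) := by
  have hu' : ContDiffAt ℝ 2 (u ∘ e.symm) y := hu.contDiffAt_comp_chart_symm (n := 2) he hy
  have hβ : DifferentiableAt ℝ (twistedDifferential (J.inChart e) (u ∘ e.symm)) y :=
    ((hu'.fderiv_right (m := 1) (by norm_num)).differentiableAt (by simp)).clm_comp hJ
  have hev : formInChart (J.pullbackDifferential u) e =ᶠ[𝓝 y] fun z =>
      ContinuousAlternatingMap.ofSubsingleton ℝ E ℝ (0 : Fin 1)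
        (twistedDifferential (J.inChart e) (u ∘ e.symm) z) := by
    have h1 := (e.continuousAt_symm hy).eventually hu.eventually_two
    filter_upwards [h1, e.open_target.mem_nhds hy] with z hz1 hz2
    exact formInChart_pullbackDifferential J he hz2 (hz1.mdifferentiableAt (by simp))
  have hd : DifferentiableAt ℝ (formInChart (J.pullbackDifferential u) e) y :=
    hβ.ofSubsingleton.congr_of_eventuallyEq hev
  have h1 := extDerivOneForm_eq_extDeriv (J.pullbackDifferential u) he (e.map_target hy)
    (by rw [e.right_inv hy]; exact hd) t (J.toFun (e.symm y) t)
  have h2 := extDeriv_ofSubsingleton_apply hβ (mfderiv 𝓘(ℝ, E) 𝓘(ℝ, E) e (e.symm y) t)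
    (mfderiv 𝓘(ℝ, E) 𝓘(ℝ, E) e (e.symm y) (J.toFun (e.symm y) t))
  rw [e.right_inv hy, hev.extDeriv_eq] at h1
  refine (congrArg Neg.neg (h1.trans h2)).trans ?_
  rw [← J.inChart_mfderiv he hy]
  rfl

/-- The trivialization of the tangent bundle at `p` is the derivative of the preferred chart at `p`,
so smoothness of `J` as a section of `End(TM)` gives smoothness of its expression in that chart,
near the base point. -/
lemma AlmostComplexStructure.contDiffAt_inChart (J : AlmostComplexStructure E M) (p : M) (n : ℕ) :
    ContDiffAt ℝ n (J.inChart (chartAt E p)) (chartAt E p p) := by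
  have : IsManifold 𝓘(ℝ, E) 1 M := IsManifold.of_le (n := ∞) (by simp)
  set e := chartAt E p with he
  have h1 := (contMDiffAt_hom_bundle _).1 (J.smooth p) |>.2
  have hmax : e ∈ IsManifold.maximalAtlas 𝓘(ℝ, E) ∞ M :=
    IsManifold.subset_maximalAtlas (chart_mem_atlas E p)
  have hpt : e p ∈ e.target := e.map_source (mem_chart_source E p)
  have hsymm : e.symm (e p) = p := e.left_inv (mem_chart_source E p)
  have h2 := ContMDiffAt.comp (e p) (by rw [hsymm]; exact h1)
    (contMDiffAt_symm_of_mem_maximalAtlas hmax hpt)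
  rw [contMDiffAt_iff_contDiffAt] at h2
  refine (h2.of_le (by exact_mod_cast le_top)).congr_of_eventuallyEq ?_
  filter_upwards [e.open_target.mem_nhds hpt] with y hy
  have hs : e.symm y ∈ (chartAt E p).source := e.map_target hy
  ext v
  simp only [Function.comp_apply, ContinuousLinearMap.inCoordinates,
    TangentBundle.continuousLinearMapAt_trivializationAt (I := 𝓘(ℝ, E)) hs,
    TangentBundle.symmL_trivializationAt (I := 𝓘(ℝ, E)) hs]
  rw [modelWithCornersSelf_coe, range_id, mfderivWithin_univ]
  have h4 : ∀ w : E, w = y → (mfderiv 𝓘(ℝ, E) 𝓘(ℝ, E) e.symm w v : E) =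
      mfderiv 𝓘(ℝ, E) 𝓘(ℝ, E) e.symm y v := by
    rintro w rfl; rfl
  have h5 := h4 (e (e.symm y)) (e.right_inv hy)
  exact congrArg (fun t : E => (mfderiv 𝓘(ℝ, E) 𝓘(ℝ, E) e (e.symm y)
    (J.toFun (e.symm y) t) : E)) h5.symm

end LeviFormInCharts

/-! ### Strict plurisubharmonicity and exhaustion on the manifold -/

section DefiningFunctionsOnManifolds

open Filter

variable {E : Type*} [NormedAddCommGroup E] [NormedSpace ℝ E]
  {M : Type*} [TopologicalSpace M] [ChartedSpace E M] {Ω U : Set M} {r : M → ℝ}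
  {k : WithTop ℕ∞}

lemma IsDefiningFunctionOn.neg_iff (hr : IsDefiningFunctionOn E k Ω U r) {q : M} (hq : q ∈ U) :
    r q < 0 ↔ q ∈ Ω := by
  have h := Set.ext_iff.1 hr.2.1 q
  simp only [mem_inter_iff, hq, and_true, mem_ofPred_eq, true_and] at h
  exact h.symm

lemma IsDefiningFunctionOn.continuousAt (hr : IsDefiningFunctionOn E k Ω U r) (hU : IsOpen U)
    {q : M} (hq : q ∈ U) : ContinuousAt r q :=
  (hr.1.contMDiffAt (hU.mem_nhds hq)).continuousAt

lemma IsDefiningFunctionOn.nonpos_of_mem_closure (hr : IsDefiningFunctionOn E k Ω U r)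
    (hU : IsOpen U) {q : M} (hq : q ∈ U) (hqΩ : q ∈ closure Ω) : r q ≤ 0 := by
  by_contra! h
  have h1 := (hr.continuousAt hU hq).eventually (lt_mem_nhds h)
  obtain ⟨z, ⟨hz1, hz2⟩, hz3⟩ :=
    mem_closure_iff_nhds.1 hqΩ _ (inter_mem h1 (hU.mem_nhds hq))
  exact absurd ((hr.neg_iff hz2).2 hz3) (not_lt.2 (le_of_lt hz1))

lemma IsDefiningFunctionOn.eq_zero_of_mem_frontier (hr : IsDefiningFunctionOn E k Ω U r)
    (hU : IsOpen U) (hΩ : IsOpen Ω) {q : M} (hq : q ∈ U) (hqΩ : q ∈ frontier Ω) : r q = 0 := by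
  rw [hΩ.frontier_eq] at hqΩ
  refine le_antisymm (hr.nonpos_of_mem_closure hU hq hqΩ.1) ?_
  by_contra! h
  exact hqΩ.2 ((hr.neg_iff hq).1 h)

/-- A zero of a defining function at which the differential does not vanish is a boundary point. -/
lemma mem_frontier_of_fderiv_ne_zero {e : OpenPartialHomeomorph M E}
    (hr : IsDefiningFunctionOn E k Ω U r)
    (hU : IsOpen U) {y : E} (hy : y ∈ e.target) (hyU : e.symm y ∈ U)
    (hu : DifferentiableAt ℝ (r ∘ e.symm) y)
    (h0 : r (e.symm y) = 0) (hd : fderiv ℝ (r ∘ e.symm) y ≠ 0) :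
    e.symm y ∈ frontier Ω := by
  have hnot : e.symm y ∉ Ω := fun h => by
    have := (hr.neg_iff hyU).2 h
    linarith
  refine ⟨?_, fun h => hnot (interior_subset h)⟩
  obtain ⟨v, hv⟩ : ∃ v, fderiv ℝ (r ∘ e.symm) y v < 0 := by
    by_contra! h
    refine hd (ContinuousLinearMap.ext fun v => le_antisymm ?_ (h v))
    simpa using h (-v)
  have h1 := eventually_pos_along_ray (u := fun z => -(r ∘ e.symm) z) (v := v) hu.fun_neg
    (by simp [h0]) (by rw [fderiv_fun_neg]; simpa using hv)
  have h2 : Tendsto (fun τ : ℝ => e.symm (y + τ • v)) (𝓝[>] 0) (𝓝 (e.symm y)) := by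
    have h3 : Tendsto (fun τ : ℝ => y + τ • v) (𝓝[>] 0) (𝓝 y) := by
      have h4 : Continuous (fun τ : ℝ => y + τ • v) := by fun_prop
      simpa using (h4.tendsto 0).mono_left (nhdsWithin_le_nhds (s := Ioi 0))
    exact (e.continuousAt_symm hy).tendsto.comp h3
  refine mem_closure_of_tendsto h2 ?_
  filter_upwards [h1, h2.eventually (hU.mem_nhds hyU)] with τ h5 h6
  exact (hr.neg_iff h6).1 (by simpa using h5)

lemma isBoundedExhaustion_neg_rpow (hΩ : IsOpen Ω) (hΩc : IsCompact (closure Ω)) (hU : IsOpen U)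
    (hΩU : closure Ω ⊆ U) {φ : M → ℝ} (hφ : ContinuousOn φ U)
    (hr : IsDefiningFunctionOn E k Ω U r) (A : ℝ) {η : ℝ} (hη : 0 < η) :
    IsBoundedExhaustion Ω (fun p => -((-r p * Real.exp (-A * φ p)) ^ η)) := by
  have hcont : ContinuousOn (fun p => -((-r p * Real.exp (-A * φ p)) ^ η)) (closure Ω) := by
    have h1 : ContinuousOn r (closure Ω) := hr.1.continuousOn.mono hΩU
    have h2 : ContinuousOn φ (closure Ω) := hφ.mono hΩU
    exact ((h1.neg.mul (Real.continuous_exp.comp_continuousOn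
      (continuousOn_const.mul h2))).rpow_const fun _ _ => Or.inr hη.le).neg
  obtain ⟨B, hB⟩ := hΩc.bddBelow_image hcont
  refine ⟨hcont.mono subset_closure, min B (-1), by simp, fun p hp => ⟨?_, ?_⟩, fun b hab hb => ?_⟩
  · exact (min_le_left _ _).trans (hB (mem_image_of_mem _ (subset_closure hp)))
  · have hrp : r p < 0 := (hr.neg_iff (hΩU (subset_closure hp))).2 hp
    exact neg_neg_of_pos
      (Real.rpow_pos_of_pos (mul_pos (neg_pos.2 hrp) (Real.exp_pos _)) _)
  -- on the boundary the function vanishes, so the sublevel sets stay away from it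
  · have heq : Ω ∩ (fun p => -((-r p * Real.exp (-A * φ p)) ^ η)) ⁻¹' Icc (min B (-1)) b =
        closure Ω ∩ (fun p => -((-r p * Real.exp (-A * φ p)) ^ η)) ⁻¹' Icc (min B (-1)) b := by
      refine Subset.antisymm (inter_subset_inter_left _ subset_closure) ?_
      rintro p ⟨hp, hpb⟩
      refine ⟨by_contra fun hpΩ => ?_, hpb⟩
      have h0 : r p = 0 := hr.eq_zero_of_mem_frontier hU hΩ (hΩU hp)
        (by rw [hΩ.frontier_eq]; exact ⟨hp, hpΩ⟩)
      have h1 := hpb.2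
      simp only [h0, neg_zero, zero_mul, Real.zero_rpow hη.ne'] at h1
      linarith
    rw [heq]
    exact hΩc.of_isClosed_subset (hcont.preimage_isClosed_of_isClosed isClosed_closure isClosed_Icc)
      inter_subset_left

lemma contMDiffAt_neg_rpow {φ : M → ℝ} {q : M} (hr : ContMDiffAt 𝓘(ℝ, E) 𝓘(ℝ, ℝ) 2 r q)
    (hφ : ContMDiffAt 𝓘(ℝ, E) 𝓘(ℝ, ℝ) 2 φ q) (hq : r q < 0) (A η : ℝ) :
    ContMDiffAt 𝓘(ℝ, E) 𝓘(ℝ, ℝ) 2 (fun p => -((-r p * Real.exp (-A * φ p)) ^ η)) q := by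
  have h : ContDiffAt ℝ 2 (fun x : ℝ × ℝ => -((-x.1 * Real.exp (-A * x.2)) ^ η)) (r q, φ q) := by
    have h1 : ContDiffAt ℝ 2 (fun x : ℝ × ℝ => -x.1 * Real.exp (-A * x.2)) (r q, φ q) := by
      fun_prop
    exact (h1.rpow_const_of_ne (mul_pos (neg_pos.2 hq) (Real.exp_pos _)).ne').neg
  exact ContDiffAt.comp_contMDiffAt (f := fun p => (r p, φ p)) h (hr.prodMk_space hφ)

variable [IsManifold 𝓘(ℝ, E) ∞ M] {e : OpenPartialHomeomorph M E}

lemma fderiv_comp_chart_symm_ne_zero (he : e ∈ atlas E M) {y : E} (hy : y ∈ e.target)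
    (hu : MDifferentiableAt 𝓘(ℝ, E) 𝓘(ℝ, ℝ) r (e.symm y))
    (h : mfderiv 𝓘(ℝ, E) 𝓘(ℝ, ℝ) r (e.symm y) ≠ 0) : fderiv ℝ (r ∘ e.symm) y ≠ 0 := by
  intro h0
  apply h
  ext t
  rw [← fderiv_comp_chart_symm_mfderiv he hy hu t, h0]
  rfl

/-- Levi convexity, expressed in a chart and for an arbitrary defining function. -/
lemma IsLeviConvexAt.localLevi_nonneg {J : AlmostComplexStructure E M} (hΩ : IsOpen Ω)
    (hr : IsDefiningFunctionOn E 2 Ω U r) (hU : IsOpen U) (he : e ∈ atlas E M) {y : E}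
    (hy : y ∈ e.target) (hyU : e.symm y ∈ U) (hyΩ : e.symm y ∈ frontier Ω)
    (hJ : DifferentiableAt ℝ (J.inChart e) y) (hL : IsLeviConvexAt J Ω (e.symm y)) {t : E}
    (ht : fderiv ℝ (r ∘ e.symm) y t = 0)
    (hJt : fderiv ℝ (r ∘ e.symm) y (J.inChart e y t) = 0) :
    0 ≤ localLevi (J.inChart e) (r ∘ e.symm) y t := by
  obtain ⟨V, s, hV, hyV, hs, hLs⟩ := hL
  have hr2 : ContMDiffAt 𝓘(ℝ, E) 𝓘(ℝ, ℝ) 2 r (e.symm y) := hr.1.contMDiffAt (hU.mem_nhds hyU)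
  have hs2 : ContMDiffAt 𝓘(ℝ, E) 𝓘(ℝ, ℝ) 2 s (e.symm y) := hs.1.contMDiffAt (hV.mem_nhds hyV)
  have hrd := hr2.mdifferentiableAt (by simp)
  have hsd := hs2.mdifferentiableAt (by simp)
  refine localLevi_nonneg_of_neg_iff (s := s ∘ e.symm) hJ (J.inChart_inChart he hy)
    (hr2.contDiffAt_comp_chart_symm (n := 2) he hy) (hs2.contDiffAt_comp_chart_symm (n := 2) he hy)
    (hr.eq_zero_of_mem_frontier hU hΩ hyU hyΩ) (hs.eq_zero_of_mem_frontier hV hΩ hyV hyΩ)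
    (fderiv_comp_chart_symm_ne_zero he hy hrd (hr.2.2 _ ⟨hyΩ, hyU⟩))
    (fderiv_comp_chart_symm_ne_zero he hy hsd (hs.2.2 _ ⟨hyΩ, hyV⟩)) ?_ ?_ ht hJt
  · filter_upwards [(e.continuousAt_symm hy).eventually (hU.mem_nhds hyU),
      (e.continuousAt_symm hy).eventually (hV.mem_nhds hyV)] with z hzU hzV
    exact (hs.neg_iff hzV).trans (hr.neg_iff hzU).symm
  · intro v hv hJv
    obtain ⟨v', rfl⟩ : ∃ v' : TangentSpace 𝓘(ℝ, E) (e.symm y),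
        mfderiv 𝓘(ℝ, E) 𝓘(ℝ, E) e (e.symm y) v' = v := ⟨_, mfderiv_chart_mfderiv_symm he hy v⟩
    have h1 := J.leviForm_eq_localLevi he hy hJ hs2 v'
    rw [J.inChart_mfderiv he hy, fderiv_comp_chart_symm_mfderiv he hy hsd] at hJv
    rw [fderiv_comp_chart_symm_mfderiv he hy hsd] at hv
    exact (hLs v' hv hJv).trans_eq h1

/-- Near a point of the closure of a Levi convex domain, the functions `-(-r e^{-A φ})^η` are
strictly plurisubharmonic on the domain for `A` large and `η` small depending on `A`; the
neighbourhood depends neither on `A` nor on `η`. -/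
lemma exists_nhds_leviForm_neg_rpow_pos [FiniteDimensional ℝ E] {J : AlmostComplexStructure E M}
    (hΩ : IsOpen Ω) (hL : IsLeviConvex J Ω) (hU : IsOpen U) {φ : M → ℝ}
    (hφ : IsStrictlyPSHOn J φ U) (hr : IsDefiningFunctionOn E 3 Ω U r) {p : M} (hpU : p ∈ U)
    (hp : p ∈ closure Ω) :
    ∃ A₀ F : ℝ, 0 < A₀ ∧ 0 < F ∧ ∀ᶠ q in 𝓝 p, q ∈ Ω → ∀ A η : ℝ, A₀ ≤ A → 0 < η → η ≤ 1 / 8 →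
      η * (A ^ 2 * F) ≤ 1 → ∀ t : TangentSpace 𝓘(ℝ, E) q, t ≠ 0 →
        0 < J.leviForm (fun p => -((-r p * Real.exp (-A * φ p)) ^ η)) q t := by
  have hr2 : IsDefiningFunctionOn E 2 Ω U r := ⟨hr.1.of_le (by norm_num), hr.2⟩
  have he : chartAt E p ∈ atlas E M := chart_mem_atlas E p
  have hps : p ∈ (chartAt E p).source := mem_chart_source E p
  have hK0 : ContDiffAt ℝ 2 (J.inChart (chartAt E p)) (chartAt E p p) := J.contDiffAt_inChart p 2
  obtain ⟨e, hee⟩ : ∃ e, e = chartAt E p := ⟨_, rfl⟩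
  rw [← hee] at he hps hK0
  obtain ⟨y₀, hy₀, rfl⟩ : ∃ y ∈ e.target, e.symm y = p := ⟨e p, e.map_source hps, e.left_inv hps⟩
  rw [e.right_inv hy₀] at hK0
  have hr3 : ContMDiffAt 𝓘(ℝ, E) 𝓘(ℝ, ℝ) 3 r (e.symm y₀) := hr.1.contMDiffAt (hU.mem_nhds hpU)
  have hφ2 : ContMDiffAt 𝓘(ℝ, E) 𝓘(ℝ, ℝ) 2 φ (e.symm y₀) := hφ.1.contMDiffAt (hU.mem_nhds hpU)
  have hu : ContDiffAt ℝ 3 (r ∘ e.symm) y₀ := hr3.contDiffAt_comp_chart_symm (n := 3) he hy₀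
  have hf : ContDiffAt ℝ 2 (φ ∘ e.symm) y₀ := hφ2.contDiffAt_comp_chart_symm (n := 2) he hy₀
  have hu2 : ContDiffAt ℝ 2 (r ∘ e.symm) y₀ := hu.of_le (by norm_num)
  have hK1 : ContDiffAt ℝ 1 (J.inChart e) y₀ := hK0.of_le (by norm_num)
  have hKd : ∀ᶠ y in 𝓝 y₀, DifferentiableAt ℝ (J.inChart e) y :=
    (hK1.eventually (by simp)).mono fun y h => h.differentiableAt (by simp)
  have htarget : ∀ᶠ y in 𝓝 y₀, y ∈ e.target := e.open_target.mem_nhds hy₀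
  have hyU : ∀ᶠ y in 𝓝 y₀, e.symm y ∈ U :=
    (e.continuousAt_symm hy₀).eventually (hU.mem_nhds hpU)
  have hK2 : ∀ᶠ y in 𝓝 y₀, ∀ t, J.inChart e y (J.inChart e y t) = -t :=
    htarget.mono fun y hy => J.inChart_inChart he hy
  obtain ⟨c, hc, hco⟩ := localLevi_coercive hK1 hf fun t ht => by
    have h1 := J.leviForm_eq_localLevi he hy₀ hKd.self_of_nhds hφ2
      (mfderiv 𝓘(ℝ, E) 𝓘(ℝ, E) e.symm y₀ t)
    rw [mfderiv_chart_mfderiv_symm he hy₀] at h1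
    rw [← h1]
    refine hφ.2 _ hpU _ fun h0 => ht ?_
    rw [← mfderiv_chart_mfderiv_symm he hy₀ t, h0, map_zero]
    rfl
  obtain ⟨C, hC, hlow⟩ : ∃ C : ℝ, 0 < C ∧ ∀ᶠ y in 𝓝 y₀, (r ∘ e.symm) y < 0 → ∀ t,
      -C * (|(r ∘ e.symm) y| * ‖t‖ ^ 2 + ‖t‖ * (|fderiv ℝ (r ∘ e.symm) y t| +
        |fderiv ℝ (r ∘ e.symm) y (J.inChart e y t)|)) ≤
        localLevi (J.inChart e) (r ∘ e.symm) y t := by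
    rcases (hr.nonpos_of_mem_closure hU hpU hp).lt_or_eq with hneg | hzero
    · exact localLevi_lower_bound_of_neg hK0 hu hneg
    · have hpf : e.symm y₀ ∈ frontier Ω := by
        rw [hΩ.frontier_eq]
        refine ⟨hp, fun h => ?_⟩
        have := (hr.neg_iff hpU).2 h
        linarith
      have hdu : fderiv ℝ (r ∘ e.symm) y₀ ≠ 0 :=
        fderiv_comp_chart_symm_ne_zero he hy₀ (hr3.mdifferentiableAt (by simp))
          (hr.2.2 _ ⟨hpf, hpU⟩)
      have hdu' : ∀ᶠ y in 𝓝 y₀, fderiv ℝ (r ∘ e.symm) y ≠ 0 :=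
        (hu2.fderiv_right (m := 1) (by norm_num)).continuousAt.eventually_ne hdu
      refine localLevi_lower_bound_of_zero hK0 hK2 hu hzero hdu ?_
      filter_upwards [hdu', htarget, hyU, hKd, hu2.eventually (by simp)]
        with y h1 h2 h3 h4 h5 h6 t h7 h8
      have hfr := mem_frontier_of_fderiv_ne_zero hr2 hU h2 h3 (h5.differentiableAt (by simp)) h6 h1
      exact (hL _ hfr).localLevi_nonneg hΩ hr2 hU he h2 h3 hfr h4 h7 h8
  obtain ⟨A₀, F, hA₀, hF, hpos⟩ := localLevi_neg_rpow_pos hK1 hK2 hu2 hf hC hc hlow hco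
  refine ⟨A₀, F, hA₀, hF, ?_⟩
  have hall := hpos.and (htarget.and (hyU.and hKd))
  have hsource : e.symm y₀ ∈ e.source := e.map_target hy₀
  have hcont : Tendsto e (𝓝 (e.symm y₀)) (𝓝 y₀) := by
    have := e.continuousAt hsource
    rwa [ContinuousAt, e.right_inv hy₀] at this
  filter_upwards [hcont.eventually hall, e.open_source.mem_nhds hsource] with q hq hqs
  obtain ⟨y, hy, rfl⟩ : ∃ y ∈ e.target, e.symm y = q := ⟨e q, e.map_source hqs, e.left_inv hqs⟩
  rw [e.right_inv hy] at hq
  obtain ⟨h1, -, h3, h4⟩ := hq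
  intro hqΩ A η hA hη hη8 hηA t ht
  have hneg : r (e.symm y) < 0 := (hr.neg_iff h3).2 hqΩ
  have hρ := contMDiffAt_neg_rpow (hr2.1.contMDiffAt (hU.mem_nhds h3))
    (hφ.1.contMDiffAt (hU.mem_nhds h3)) hneg A η
  rw [J.leviForm_eq_localLevi he hy h4 hρ]
  refine h1 hneg A η hA hη hη8 hηA _ fun h0 => ht ?_
  have h5 := mfderiv_symm_mfderiv_chart he hy t
  have h6 : ∀ w : E, w = 0 → (mfderiv 𝓘(ℝ, E) 𝓘(ℝ, E) e.symm y w : E) = 0 := by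
    rintro w rfl; exact map_zero _
  exact h5.symm.trans (h6 _ h0)

/-- The version of `exists_nhds_leviForm_neg_rpow_pos` on a neighbourhood of a compact set. -/
lemma exists_open_leviForm_neg_rpow_pos [FiniteDimensional ℝ E] {J : AlmostComplexStructure E M}
    (hΩ : IsOpen Ω) (hL : IsLeviConvex J Ω) (hU : IsOpen U) {φ : M → ℝ}
    (hφ : IsStrictlyPSHOn J φ U) (hr : IsDefiningFunctionOn E 3 Ω U r) {S : Set M}
    (hS : IsCompact S) (hSU : S ⊆ U) (hSΩ : S ⊆ closure Ω) :
    ∃ W : Set M, IsOpen W ∧ S ⊆ W ∧ W ⊆ U ∧ ∃ A₀ F : ℝ, 0 < A₀ ∧ 0 < F ∧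
      ∀ q ∈ W, q ∈ Ω → ∀ A η : ℝ, A₀ ≤ A → 0 < η → η ≤ 1 / 8 → η * (A ^ 2 * F) ≤ 1 →
        ∀ t : TangentSpace 𝓘(ℝ, E) q, t ≠ 0 →
          0 < J.leviForm (fun p => -((-r p * Real.exp (-A * φ p)) ^ η)) q t := by
  refine hS.induction_on (p := fun S => ∃ W : Set M, IsOpen W ∧ S ⊆ W ∧ W ⊆ U ∧ ∃ A₀ F : ℝ,
    0 < A₀ ∧ 0 < F ∧ ∀ q ∈ W, q ∈ Ω → ∀ A η : ℝ, A₀ ≤ A → 0 < η → η ≤ 1 / 8 →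
      η * (A ^ 2 * F) ≤ 1 → ∀ t : TangentSpace 𝓘(ℝ, E) q, t ≠ 0 →
        0 < J.leviForm (fun p => -((-r p * Real.exp (-A * φ p)) ^ η)) q t) ?_ ?_ ?_ ?_
  · exact ⟨∅, isOpen_empty, Subset.rfl, empty_subset _, 1, 1, one_pos, one_pos,
      fun q hq => absurd hq (notMem_empty q)⟩
  · rintro S T hST ⟨W, hW, hTW, h⟩
    exact ⟨W, hW, hST.trans hTW, h⟩
  · rintro S T ⟨W₁, hW₁, hS₁, hU₁, A₁, F₁, hA₁, hF₁, h₁⟩ ⟨W₂, hW₂, hS₂, hU₂, A₂, F₂, hA₂, hF₂, h₂⟩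
    refine ⟨W₁ ∪ W₂, hW₁.union hW₂, union_subset_union hS₁ hS₂, union_subset hU₁ hU₂,
      max A₁ A₂, max F₁ F₂, lt_max_of_lt_left hA₁, lt_max_of_lt_left hF₁, ?_⟩
    intro q hq hqΩ A η hA hη hη8 hηA
    rcases hq with hq | hq
    · refine h₁ q hq hqΩ A η ((le_max_left _ _).trans hA) hη hη8 (le_trans ?_ hηA)
      gcongr
      exact le_max_left _ _
    · refine h₂ q hq hqΩ A η ((le_max_right _ _).trans hA) hη hη8 (le_trans ?_ hηA)
      gcongr
      exact le_max_right _ _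
  · intro p hp
    obtain ⟨A₀, F, hA₀, hF, h⟩ :=
      exists_nhds_leviForm_neg_rpow_pos hΩ hL hU hφ hr (hSU hp) (hSΩ hp)
    obtain ⟨W, hW, hWo, hpW⟩ := eventually_nhds_iff.1 (h.and (hU.mem_nhds (hSU hp)))
    exact ⟨W, mem_nhdsWithin_of_mem_nhds (hWo.mem_nhds hpW), W, hWo, Subset.rfl,
      fun q hq => (hW q hq).2, A₀, F, hA₀, hF, fun q hq => (hW q hq).1⟩

end DefiningFunctionsOnManifolds

theorem theorem1
    {E : Type*} [NormedAddCommGroup E] [NormedSpace ℝ E] [FiniteDimensional ℝ E]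
    {M : Type*} [TopologicalSpace M] [T2Space M] [ChartedSpace E M] [IsManifold 𝓘(ℝ, E) ∞ M]
    (J : AlmostComplexStructure E M)
    (Ω : Set M) (hΩ_open : IsOpen Ω) (hΩ_conn : IsConnected Ω) (hΩ_cpt : IsCompact (closure Ω))
    (hΩ_bdry : HasBoundaryOfClass E 3 Ω) (hΩ_levi : IsLeviConvex J Ω)
    (U : Set M) (hU_open : IsOpen U) (hU : frontier Ω ⊆ U)
    (φ : M → ℝ) (hφ : IsStrictlyPSHOn J φ U)
    (r : M → ℝ) (hr : IsDefiningFunctionOn E 3 Ω U r) :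
    ∃ U' : Set M, IsOpen U' ∧ frontier Ω ⊆ U' ∧ U' ⊆ U ∧
      ∃ A η₀ : ℝ, 0 < A ∧ 0 < η₀ ∧ η₀ < 1 ∧
        ∀ η : ℝ, 0 < η → η ≤ η₀ →
          IsStrictlyPSHOn J (fun p => -((-r p * Real.exp (-A * φ p)) ^ η)) (Ω ∩ U') ∧
          (closure Ω ⊆ U →
            IsStrictlyPSHOn J (fun p => -((-r p * Real.exp (-A * φ p)) ^ η)) Ω ∧
            IsBoundedExhaustion Ω (fun p => -((-r p * Real.exp (-A * φ p)) ^ η))) := by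
  -- the neighbourhood is taken around the whole closure as soon as this makes sense
  obtain ⟨S, hSc, hSU, hSΩ, hfS, hS⟩ : ∃ S : Set M, IsCompact S ∧ S ⊆ U ∧ S ⊆ closure Ω ∧
      frontier Ω ⊆ S ∧ (closure Ω ⊆ U → closure Ω ⊆ S) := by
    by_cases h : closure Ω ⊆ U
    · exact ⟨closure Ω, hΩ_cpt, h, Subset.rfl, frontier_subset_closure, fun _ => Subset.rfl⟩
    · exact ⟨frontier Ω, hΩ_cpt.of_isClosed_subset isClosed_frontier frontier_subset_closure, hU,
        frontier_subset_closure, Subset.rfl, fun h' => absurd h' h⟩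
  obtain ⟨W, hWo, hSW, hWU, A, F, hA, hF, hpos⟩ :=
    exists_open_leviForm_neg_rpow_pos hΩ_open hΩ_levi hU_open hφ hr hSc hSU hSΩ
  have hAF : 0 < A ^ 2 * F := by positivity
  refine ⟨W, hWo, hfS.trans hSW, hWU, A, min (1 / 8) (1 / (A ^ 2 * F)), hA, by positivity,
    (min_le_left _ _).trans_lt (by norm_num), fun η hη hη₀ => ?_⟩
  have hpsh : IsStrictlyPSHOn J (fun p => -((-r p * Real.exp (-A * φ p)) ^ η)) (Ω ∩ W) := by
    refine ⟨fun q hq => ?_, fun q hq t ht => ?_⟩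
    · have hqU := hWU hq.2
      exact (contMDiffAt_neg_rpow ((hr.1.contMDiffAt (hU_open.mem_nhds hqU)).of_le (by norm_num))
        (hφ.1.contMDiffAt (hU_open.mem_nhds hqU)) ((hr.neg_iff hqU).2 hq.1) A η).contMDiffWithinAt
    · exact hpos q hq.2 hq.1 A η le_rfl hη (hη₀.trans (min_le_left _ _))
        ((le_div_iff₀ hAF).1 (hη₀.trans (min_le_right _ _))) t ht
  refine ⟨hpsh, fun hΩU => ⟨?_, isBoundedExhaustion_neg_rpow hΩ_open hΩ_cpt hU_open hΩU
    hφ.1.continuousOn hr A hη⟩⟩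
  rwa [inter_eq_left.2 (subset_closure.trans ((hS hΩU).trans hSW))] at hpsh
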